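/- Conventions. A simplicial complex is an abstract one (a family of nonempty finite subsets, called simplices, of a vertex set, closed under passing to nonempty subsets and containing all singletons); topological terms refer to its geometric realization with the weak topology. A space is $m$-connected ($m\in\mathbb Z$) if it is nonempty when $m\ge -1$ and every continuous map $S^k\to T$ into the space $T$ with $0\le k\le m$ is homotopic to a constant map; every space is $m$-connected for $m\le -2$. The link $\mathrm{Lk}_K\,\sigma$ of a simplex $\sigma$ of $K$ consists of the simplices $\tau$ of $K$ that are disjoint from $\sigma$ and for which $\tau\cup\sigma$ is a simplex of $K$. For $n\in\mathbb Z$, $K$ is weakly Cohen–Macaulay of dimension $n$, written $\mathrm{wCM}(K)\ge n$, if $K$ is $(n-1)$-connected and the link of every $p$-simplex of $K$ is $(n-p-2)$-connected, for every $p\ge 0$. Let $\pi\colon Y\to X$ be a surjective simplicial map of simplicial complexes. For a set $S$ of vertices of $Y$, an $S$-section of $\pi$ is a simplicial map $\rho\colon X\to Y$ with $\pi\circ\rho=\mathrm{id}_X$ such that for all simplices $\sigma$ of $Y$ with all vertices in $S$ and all simplices $\tau$ of $X$, $$\tau\in\mathrm{Lk}_X\,\pi(\sigma)\iff\rho(\tau)\in\mathrm{Lk}_Y\,\sigma.$$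 The map $\pi$ is a fin-retraction if it has an $S$-section for every finite set $S$ of vertices of $Y$. It is simplexwise injective if it is injective on the vertices of every simplex of $Y$ (equivalently, $\pi$ maps $\mathrm{Lk}_Y\,\sigma$ into $\mathrm{Lk}_X\,\pi(\sigma)$ for every simplex $\sigma$ of $Y$). Proposition. Let $\pi\colon Y\to X$ be a fin-retraction, let $n\in\mathbb Z$, and suppose $\mathrm{wCM}(X)\ge n$. Then $Y$ is $(n-1)$-connected. If moreover $\pi$ is simplexwise injective, then $\mathrm{wCM}(Y)\ge n$. -/

import Mathlib

/-- A topological space `T` is `m`-connected (`m : ℤ`) if it is nonempty when `m ≥ -1`, and every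
continuous map `S^k → T` with `0 ≤ k ≤ m` is homotopic to a constant map.
In particular `(-1)`-connected means nonempty, and every space is `m`-connected for `m ≤ -2`. -/
def IsNConnected (m : ℤ) (T : Type*) [TopologicalSpace T] : Prop :=
  (-1 ≤ m → Nonempty T) ∧
    ∀ k : ℕ, (k : ℤ) ≤ m →
      ∀ f : C(Metric.sphere (0 : EuclideanSpace ℝ (Fin (k + 1))) 1, T), f.Nullhomotopic

namespace PreAbstractSimplicialComplex

/-- The closed geometric simplex spanned by a finite set `s` of vertices, in barycentric
coordinates. -/
def geometricSimplex {V : Type*} (s : Finset V) : Set (V → ℝ) :=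
  {x | (∀ v, 0 ≤ x v) ∧ (∀ v, v ∉ s → x v = 0) ∧ ∑ v ∈ s, x v = 1}

/-- The points of the geometric realization: the union of the closed simplices spanned by the
faces of `K`. -/
def Realization {V : Type*} (K : PreAbstractSimplicialComplex V) : Type _ :=
  {x : V → ℝ // ∃ s ∈ K.faces, x ∈ geometricSimplex s}

/-- The inclusion of the closed simplex spanned by a face into the realization. -/
def faceInclusion {V : Type*} (K : PreAbstractSimplicialComplex V) (s : K.faces) :
    geometricSimplex s.1 → K.Realization :=
  fun x => ⟨x.1, s.1, s.2, x.2⟩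

/-- The weak topology on the realization: a set is open (closed) if and only if its intersection
with every closed simplex is open (closed) in the Euclidean topology of that simplex. -/
instance {V : Type*} (K : PreAbstractSimplicialComplex V) : TopologicalSpace K.Realization :=
  ⨆ s : K.faces, TopologicalSpace.coinduced (K.faceInclusion s) inferInstance

/-- The link of `s` in `K`: the faces `t` of `K` disjoint from `s` such that `t ∪ s` is a
face of `K`. -/
def link {V : Type*} [DecidableEq V] (K : PreAbstractSimplicialComplex V) (s : Finset V) :
    PreAbstractSimplicialComplex V where
  faces := {t | t ∈ K.faces ∧ Disjoint t s ∧ t ∪ s ∈ K.faces}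
  isRelLowerSet_faces := by
    rintro t ⟨ht, hd, hu⟩
    refine ⟨(K.isRelLowerSet_faces ht).1, fun r hr hne => ⟨?_, ?_, ?_⟩⟩
    · exact (K.isRelLowerSet_faces ht).2 hr hne
    · exact Finset.disjoint_of_subset_left hr hd
    · exact (K.isRelLowerSet_faces hu).2 (Finset.union_subset_union_left hr)
        (hne.mono Finset.subset_union_left)

/-- `K` is weakly Cohen–Macaulay of dimension `n` (`wCM(K) ≥ n`): its realization is
`(n-1)`-connected and the link of every `p`-simplex is `(n-p-2)`-connected. -/
def IsWeaklyCohenMacaulay {V : Type*} [DecidableEq V] (K : PreAbstractSimplicialComplex V)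
    (n : ℤ) : Prop :=
  IsNConnected (n - 1) K.Realization ∧
    ∀ s ∈ K.faces, ∀ p : ℕ, s.card = p + 1 → IsNConnected (n - p - 2) (K.link s).Realization

end PreAbstractSimplicialComplex

namespace AbstractSimplicialComplex

/-- A map of vertices is simplicial if the image of each simplex is a simplex. -/
def IsSimplicialMap {V W : Type*} [DecidableEq W] (Y : AbstractSimplicialComplex V)
    (X : AbstractSimplicialComplex W) (f : V → W) : Prop :=
  ∀ s ∈ Y.faces, s.image f ∈ X.faces

/-- Surjectivity of a simplicial map: every simplex of `X` is the image of a simplex of `Y`. -/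
def IsSurjectiveOnSimplices {V W : Type*} [DecidableEq W] (Y : AbstractSimplicialComplex V)
    (X : AbstractSimplicialComplex W) (f : V → W) : Prop :=
  ∀ t ∈ X.faces, ∃ s ∈ Y.faces, s.image f = t

/-- `ρ : X → Y` is an `S`-section of `π : Y → X`: it is a simplicial map with `π ∘ ρ = id`
such that for each simplex `s` of `Y` with vertices in `S` and each simplex `t` of `X`,
`t` lies in the link of `π s` if and only if `ρ t` lies in the link of `s`. -/
def IsSSection {V W : Type*} [DecidableEq V] [DecidableEq W] (Y : AbstractSimplicialComplex V)
    (X : AbstractSimplicialComplex W) (π : V → W) (S : Set V) (ρ : W → V) : Prop :=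
  IsSimplicialMap X Y ρ ∧ (∀ w, π (ρ w) = w) ∧
    ∀ s ∈ Y.faces, (s : Set V) ⊆ S → ∀ t ∈ X.faces,
      (t ∈ (X.toPreAbstractSimplicialComplex.link (s.image π)).faces ↔
        t.image ρ ∈ (Y.toPreAbstractSimplicialComplex.link s).faces)

/-- A fin-retraction: a surjective simplicial map that has an `S`-section for every finite set
`S` of vertices of `Y`. -/
def IsFinRetraction {V W : Type*} [DecidableEq V] [DecidableEq W]
    (Y : AbstractSimplicialComplex V) (X : AbstractSimplicialComplex W) (π : V → W) : Prop :=
  IsSimplicialMap Y X π ∧ IsSurjectiveOnSimplices Y X π ∧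
    ∀ S : Set V, S.Finite → ∃ ρ : W → V, IsSSection Y X π S ρ

/-- `π` is injective on the vertices of each simplex of `Y`. -/
def IsSimplexwiseInjective {V W : Type*} (Y : AbstractSimplicialComplex V) (π : V → W) : Prop :=
  ∀ s ∈ Y.faces, Set.InjOn π (s : Set V)

end AbstractSimplicialComplex

/-! Let `f : S^k → |Y|` with `k ≤ n - 1`. By compactness `f` meets only the simplices of `Y` with
vertices in a finite set `S`; let `G` be the finite set of these simplices. The complex `J =
linkJoin X π G` on the disjoint union of the vertex sets has the simplices `a ⊔ b` with `a ∈ G` or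
empty, `b` a simplex of `X` or empty, and `b ∈ Lk (π a)` if both are nonempty. An `S`-section `ρ`
makes `id ⊔ ρ : J → Y` simplicial, and `f` factors through it, so it suffices that `J` is
`(n-1)`-connected (`isNConnected_of_sections`).

`J` arises from `X` by attaching the simplices of `G` in order of dimension. A `p`-simplex `σ` is
attached along `∂σ * Lk_X (π σ)`. The link is at least `(n-p-2)`-connected and joining with the
`(p-1)`-sphere `∂σ` adds `p`, so the attaching locus is `(n-2)`-connected and `(n-1)`-connectivity
survives (`isNConnected_linkJoin`). This rests on `Realization.isNConnected_of_deletion`, itself a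
case of the gluing theorem `IsNConnected.of_open_cover`, which is proved by hand by extending maps
cell by cell over a fine grid.

For the second claim, simplexwise injectivity makes `π` restrict to `Lk_Y s → Lk_X (π s)`. The `(S ∪
s)`-sections supply what the first argument needs for this restriction, and the target is weakly
Cohen–Macaulay of dimension `n - p - 1`. -/

/-! ### Extending maps from the boundary of a cube -/

/-- The boundary of the unit cube `[0, 1]^ι`. -/
def cubeFrontier (ι : Type*) : Set (ι → ℝ) :=
  {x | x ∈ Set.Icc 0 1 ∧ ∃ i, x i = 0 ∨ x i = 1}

/-- Every map from the boundary of the cube `[0, 1]^ι` to `A` extends to the cube. -/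
def CubeExtension (ι : Type*) {T : Type*} [TopologicalSpace T] (A : Set T) : Prop :=
  ∀ f : (ι → ℝ) → T, ContinuousOn f (cubeFrontier ι) → Set.MapsTo f (cubeFrontier ι) A →
    ∃ F : (ι → ℝ) → T, ContinuousOn F (Set.Icc 0 1) ∧ Set.MapsTo F (Set.Icc 0 1) A ∧
      Set.EqOn F f (cubeFrontier ι)

/-- The homotopy is run along rays: at radius `r` between `1/2` and `1` its time is `2 - 2r`,
clamped to `0` beyond the unit sphere, and the final constant fills the ball of radius `1/2`, so
that `x / ‖x‖` is only used away from the origin. -/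
theorem ContinuousMap.Nullhomotopic.exists_extension {E T : Type*} [NormedAddCommGroup E]
    [NormedSpace ℝ E] [TopologicalSpace T] {f : C(Metric.sphere (0 : E) 1, T)}
    (hf : f.Nullhomotopic) : ∃ F : C(E, T), ∀ z : Metric.sphere (0 : E) 1, F z = f z := by
  obtain ⟨y, ⟨H⟩⟩ := hf
  have hmem (x : E) (h : 1 / 2 ≤ ‖x‖) : ‖x‖⁻¹ • x ∈ Metric.sphere (0 : E) 1 := by
    have : ‖x‖ ≠ 0 := by positivity
    simp [norm_smul, this]
  let F : E → T := fun x => if h : 1 / 2 ≤ ‖x‖ then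
    H (Set.projIcc 0 1 zero_le_one (2 - 2 * ‖x‖), ⟨‖x‖⁻¹ • x, hmem x h⟩) else y
  have h1 : ContinuousOn F {x | 1 / 2 ≤ ‖x‖} := by
    rw [continuousOn_iff_continuous_domRestrict]
    have : Set.domRestrict {x : E | 1 / 2 ≤ ‖x‖} F = fun x =>
        H (Set.projIcc 0 1 zero_le_one (2 - 2 * ‖x.1‖), ⟨‖x.1‖⁻¹ • x.1, hmem x.1 x.2⟩) := by
      ext x
      exact dif_pos x.2
    rw [this]
    have h0 (x : {x : E | 1 / 2 ≤ ‖x‖}) : ‖x.1‖ ≠ 0 := by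
      have := x.2
      simp only [Set.mem_ofPred_eq] at this
      positivity
    refine H.continuous.comp (Continuous.prodMk ?_ ?_)
    · exact continuous_projIcc.comp (by fun_prop)
    · exact Continuous.subtype_mk (by fun_prop (disch := exact h0)) _
  have h2 : ContinuousOn F {x | ‖x‖ ≤ 1 / 2} := by
    refine (continuousOn_const (c := y)).congr fun x hx => ?_
    simp only [F]
    split_ifs with h
    · have hx : ‖x‖ = 1 / 2 := le_antisymm hx h
      have : Set.projIcc (0 : ℝ) 1 zero_le_one (2 - 2 * ‖x‖) = 1 := by
        rw [hx]; norm_num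
      rw [this]
      simp
    · rfl
  have h3 : Continuous F := by
    rw [← continuousOn_univ]
    refine (h1.union_of_isClosed h2 (isClosed_le continuous_const continuous_norm)
      (isClosed_le continuous_norm continuous_const)).mono fun x _ => ?_
    exact le_total (1 / 2) ‖x‖
  refine ⟨⟨F, h3⟩, fun z => ?_⟩
  have hz : ‖z.1‖ = 1 := by simp
  have : Set.projIcc (0 : ℝ) 1 zero_le_one (2 - 2 * ‖z.1‖) = 0 := by
    rw [hz]; norm_num
  simp only [ContinuousMap.coe_mk, F]
  rw [dif_pos (by rw [hz]; norm_num), this]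
  simp [hz]

theorem frontier_Icc_zero_one (ι : Type*) [Fintype ι] :
    frontier (Set.Icc (0 : ι → ℝ) 1) = cubeFrontier ι := by
  rw [isClosed_Icc.frontier_eq, ← Set.pi_univ_Icc, interior_pi_set Set.finite_univ]
  ext x
  simp only [Pi.zero_apply, Pi.one_apply, interior_Icc, cubeFrontier, Set.mem_sdiff, Set.mem_pi,
    Set.mem_univ, true_imp_iff, Set.mem_Ioo, ← Set.pi_univ_Icc, Set.mem_ofPred_eq]
  refine and_congr_right fun h => ?_
  push Not
  refine exists_congr fun i => ?_
  have := h i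
  simp only [Set.mem_Icc] at this
  constructor
  · intro h'
    rcases this.1.eq_or_lt with h0 | h0
    · exact Or.inl h0.symm
    · exact Or.inr (le_antisymm this.2 (h' h0))
  · rintro (h' | h') h0
    · linarith
    · exact h'.ge

/-- Ball and cube are bounded convex bodies with interior. The homeomorphism is one of ambient
spaces, so that an extension to all of Euclidean space can be carried over to the cube. -/
theorem exists_homeomorph_sphere_cubeFrontier (ι : Type*) [Fintype ι] (k : ℕ)
    (hk : Fintype.card ι = k + 1) : ∃ h : EuclideanSpace ℝ (Fin (k + 1)) ≃ₜ (ι → ℝ),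
      ∀ x, x ∈ Metric.sphere 0 1 ↔ h x ∈ cubeFrontier ι := by
  have e : Fin (k + 1) ≃ ι := (Fintype.equivFinOfCardEq hk).symm
  let L : EuclideanSpace ℝ (Fin (k + 1)) ≃L[ℝ] (ι → ℝ) :=
    (EuclideanSpace.equiv (Fin (k + 1)) ℝ).trans
      (LinearEquiv.funCongrLeft ℝ ℝ e.symm).toContinuousLinearEquiv
  let s : Set (EuclideanSpace ℝ (Fin (k + 1))) := L ⁻¹' Set.Icc 0 1
  have hc : Convex ℝ s := (convex_Icc 0 1).linear_preimage L.toLinearMap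
  have hint : interior s = L ⁻¹' (interior (Set.Icc 0 1)) :=
    (L.toHomeomorph.preimage_interior _).symm
  have hfr : frontier s = L ⁻¹' (cubeFrontier ι) := by
    rw [← frontier_Icc_zero_one]
    exact (L.toHomeomorph.preimage_frontier _).symm
  have hne : (interior s).Nonempty := by
    rw [hint]
    refine Set.Nonempty.preimage ?_ L.surjective
    rw [← Set.pi_univ_Icc, interior_pi_set Set.finite_univ]
    refine ⟨fun _ => 1 / 2, fun i _ => ?_⟩
    simp only [Pi.zero_apply, Pi.one_apply, interior_Icc, Set.mem_Ioo]
    norm_num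
  have hb : Bornology.IsBounded s := by
    have hK : IsCompact s := L.toHomeomorph.isCompact_preimage.2 isCompact_Icc
    exact hK.isBounded
  obtain ⟨h, -, -, h3⟩ := exists_homeomorph_image_interior_closure_frontier_eq_unitBall hc hne hb
  refine ⟨h.symm.trans L.toHomeomorph, fun x => ?_⟩
  rw [← h3, hfr]
  constructor
  · rintro ⟨y, hy, rfl⟩
    simpa using hy
  · intro hx
    exact ⟨h.symm x, hx, by simp⟩

/-- Extension over cubes of low dimension in an `m`-connected subset. -/
theorem IsNConnected.cubeExtension {T : Type*} [TopologicalSpace T] {A : Set T} {m : ℤ}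
    (hA : IsNConnected m A) (ι : Type*) [Fintype ι] (hι : (Fintype.card ι : ℤ) ≤ m + 1) :
    CubeExtension ι A := by
  intro f hf hfA
  -- The `0`-dimensional cube is a point with empty boundary, so extension only asks for a point of
  -- `A`. A cube of dimension `k + 1` has boundary `S^k`.
  rcases h : Fintype.card ι with _ | k
  · have := Fintype.card_eq_zero_iff.1 h
    obtain ⟨a⟩ := hA.1 (by rw [h] at hι; push_cast at hι; linarith)
    exact ⟨fun _ => a, continuousOn_const, fun _ _ => a.2, fun x hx => isEmptyElim hx.2.choose⟩
  · obtain ⟨h, hh⟩ := exists_homeomorph_sphere_cubeFrontier ι k h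
    have hk : (k : ℤ) ≤ m := by
      rw [‹Fintype.card ι = k + 1›] at hι; push_cast at hι; linarith
    let g : C(Metric.sphere (0 : EuclideanSpace ℝ (Fin (k + 1))) 1, A) :=
      ⟨fun z => ⟨f (h z.1), hfA ((hh z.1).1 z.2)⟩, Continuous.subtype_mk
        (hf.comp_continuous (f := fun z : Metric.sphere (0 : EuclideanSpace ℝ (Fin (k + 1))) 1 =>
          h z.1) (by fun_prop) fun z => (hh z.1).1 z.2) _⟩
    obtain ⟨F, hF⟩ := (hA.2 k hk g).exists_extension
    refine ⟨fun x => F (h.symm x), ?_, fun x _ => (F _).2, fun x hx => ?_⟩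
    · exact (by fun_prop : Continuous fun x => (F (h.symm x) : T)).continuousOn
    · have hx' : h.symm x ∈ Metric.sphere 0 1 := (hh _).2 (by simpa using hx)
      simpa [g] using congrArg Subtype.val (hF ⟨h.symm x, hx'⟩)

/-! ### Cell-by-cell extension over an integral grid -/

/-- Integral boxes in `ℝ^D`, given by their lower and upper corners and ordered by inclusion. -/
abbrev GridCell (D : Type*) := (D → ℤ)ᵒᵈ × (D → ℤ)

namespace GridCell

variable {D : Type*}

/-- The lower corner. -/
def lo (c : GridCell D) : D → ℤ := OrderDual.ofDual c.1

/-- The upper corner. -/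
def hi (c : GridCell D) : D → ℤ := c.2

/-- The closed box with the given corners. -/
def box (c : GridCell D) : Set (D → ℝ) := {x | ∀ i, (c.lo i : ℝ) ≤ x i ∧ x i ≤ c.hi i}

/-- The sides of the box have length `0` or `1`. -/
def IsUnit (c : GridCell D) : Prop := ∀ i, c.lo i ≤ c.hi i ∧ c.hi i ≤ c.lo i + 1

/-- The cell that contains `x` in its relative interior. -/
noncomputable def ofPoint (x : D → ℝ) : GridCell D := (OrderDual.toDual fun i => ⌊x i⌋, fun i => ⌈x i⌉)

@[simp] theorem lo_ofPoint (x : D → ℝ) (i : D) : (ofPoint x).lo i = ⌊x i⌋ := rfl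

@[simp] theorem hi_ofPoint (x : D → ℝ) (i : D) : (ofPoint x).hi i = ⌈x i⌉ := rfl

theorem le_iff {c c' : GridCell D} :
    c ≤ c' ↔ (∀ i, c'.lo i ≤ c.lo i) ∧ ∀ i, c.hi i ≤ c'.hi i := Iff.rfl

theorem ext_iff {c c' : GridCell D} :
    c = c' ↔ (∀ i, c.lo i = c'.lo i) ∧ ∀ i, c.hi i = c'.hi i := by
  rw [Prod.ext_iff, ← OrderDual.ofDual_inj, funext_iff, funext_iff]
  rfl

theorem ofPoint_le_iff {c : GridCell D} {x : D → ℝ} : ofPoint x ≤ c ↔ x ∈ c.box := by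
  simp only [le_iff, lo_ofPoint, hi_ofPoint, Int.le_floor, Int.ceil_le, box, Set.mem_ofPred_eq,
    forall_and]

theorem mem_box_ofPoint (x : D → ℝ) : x ∈ (ofPoint x).box := ofPoint_le_iff.1 le_rfl

theorem box_mono {c c' : GridCell D} (h : c ≤ c') : c.box ⊆ c'.box := fun _ hx =>
  ofPoint_le_iff.1 ((ofPoint_le_iff.2 hx).trans h)

theorem isUnit_ofPoint (x : D → ℝ) : (ofPoint x).IsUnit := fun _ =>
  ⟨Int.floor_le_ceil _, Int.ceil_le_floor_add_one _⟩

theorem isClosed_box (c : GridCell D) : IsClosed c.box := by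
  simp only [box, Set.ofPred_forall, Set.ofPred_and]
  exact isClosed_iInter fun i => (isClosed_le continuous_const (continuous_apply i)).inter
    (isClosed_le (continuous_apply i) continuous_const)

/-- The union of the relative interiors of the cells in `C`. -/
def support (C : Finset (GridCell D)) : Set (D → ℝ) := {x | ofPoint x ∈ C}

/-- `C` contains the faces of its cells. -/
def FaceClosed (C : Finset (GridCell D)) : Prop := ∀ c ∈ C, ∀ x ∈ c.box, ofPoint x ∈ C

theorem FaceClosed.isClosed_support {C : Finset (GridCell D)} (hC : FaceClosed C) :
    IsClosed (support C) := by
  have : support C = ⋃ c ∈ C, c.box := by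
    ext x
    simp only [support, Set.mem_ofPred_eq, Set.mem_iUnion]
    exact ⟨fun h => ⟨_, h, mem_box_ofPoint x⟩, fun ⟨c, hc, hx⟩ => hC c hc x hx⟩
  rw [this]
  exact C.finite_toSet.isClosed_biUnion fun c _ => c.isClosed_box

/-- The points of the box whose cell is not `c` form its relative boundary. The map `q` parametrizes
the box by the unit cube on the directions in which `c` is nondegenerate, and `p` is its inverse
there. -/
theorem exists_extension_box {T : Type*} [TopologicalSpace T] {c : GridCell D} (hc : c.IsUnit)
    {A : Set T} (hA : CubeExtension {i // c.lo i < c.hi i} A) {f : (D → ℝ) → T}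
    (hf : ContinuousOn f (c.box ∩ {x | ofPoint x ≠ c}))
    (hfA : Set.MapsTo f (c.box ∩ {x | ofPoint x ≠ c}) A) :
    ∃ F : (D → ℝ) → T, ContinuousOn F c.box ∧ Set.MapsTo F c.box A ∧
      Set.EqOn F f (c.box ∩ {x | ofPoint x ≠ c}) := by
  classical
  let q : ({i // c.lo i < c.hi i} → ℝ) → D → ℝ := fun y i =>
    if h : c.lo i < c.hi i then c.lo i + y ⟨i, h⟩ else c.lo i
  let p : (D → ℝ) → {i // c.lo i < c.hi i} → ℝ := fun x i => x i - c.lo i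
  have hq : Continuous q := by
    refine continuous_pi fun i => ?_
    by_cases h : c.lo i < c.hi i
    · simp only [q, dif_pos h]; fun_prop
    · simp only [q, dif_neg h]; fun_prop
  have hp : Continuous p := by fun_prop
  have hhi (i : D) (h : c.lo i < c.hi i) : c.hi i = c.lo i + 1 := by
    have := hc i
    omega
  have hqf : Set.MapsTo q (cubeFrontier _) (c.box ∩ {x | ofPoint x ≠ c}) := by
    rintro y ⟨hy, j, hj⟩
    refine ⟨fun i => ?_, fun h => ?_⟩
    · by_cases h : c.lo i < c.hi i
      · have h0 := hy.1 ⟨i, h⟩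
        have h1 := hy.2 ⟨i, h⟩
        simp only [q, dif_pos h, hhi i h]
        simp only [Pi.zero_apply, Pi.one_apply] at h0 h1
        push_cast
        constructor <;> linarith
      · simp only [q, dif_neg h]
        exact ⟨le_rfl, by exact_mod_cast (hc i).1⟩
    · have hqj : q y j = c.lo j + y j := by simp only [q, dif_pos j.2]
      have hlo := (ext_iff.1 h).1 j
      have hhi' := (ext_iff.1 h).2 j
      have := hhi j j.2
      rw [lo_ofPoint, hqj] at hlo
      rw [hi_ofPoint, hqj] at hhi'
      rcases hj with hj | hj <;> simp [hj] at hlo hhi'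
      omega
  have hpb : Set.MapsTo p c.box (Set.Icc 0 1) := by
    intro x hx
    refine ⟨fun i => ?_, fun i => ?_⟩
    · have := (hx i).1
      simp only [Pi.zero_apply, p]; linarith
    · have := (hx i).2
      rw [hhi i i.2] at this
      push_cast at this
      simp only [Pi.one_apply, p]; linarith
  have hqp (x : D → ℝ) (hx : x ∈ c.box) : q (p x) = x := by
    ext i
    by_cases h : c.lo i < c.hi i
    · simp [q, p, h]
    · have h1 : c.lo i = c.hi i := by have := hc i; omega
      have h2 := hx i
      rw [← h1] at h2
      simp only [q, dif_neg h]
      exact le_antisymm h2.1 h2.2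
  have hpf : Set.MapsTo p (c.box ∩ {x | ofPoint x ≠ c}) (cubeFrontier _) := by
    rintro x ⟨hx, hne⟩
    refine ⟨hpb hx, ?_⟩
    by_contra! hcon
    refine hne (ext_iff.2 ⟨fun i => ?_, fun i => ?_⟩)
    all_goals
      have h2 := hx i
      by_cases h : c.lo i < c.hi i
      · have h3 := hcon ⟨i, h⟩
        have h4 := hhi i h
        have h5 : (c.hi i : ℝ) = c.lo i + 1 := by rw [h4]; push_cast; rfl
        have h6 : (c.lo i : ℝ) < x i := lt_of_le_of_ne h2.1 fun h' => h3.1 (by simp [p, h'])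
        have h7 : x i < c.hi i := lt_of_le_of_ne h2.2 fun h' => h3.2 (by simp [p, h', h5])
        first
        | rw [lo_ofPoint, Int.floor_eq_iff]; constructor <;> linarith
        | rw [hi_ofPoint, Int.ceil_eq_iff]; constructor <;> linarith
      · have h1 : c.lo i = c.hi i := by have := hc i; omega
        have h3 : x i = c.lo i := le_antisymm (by rw [h1]; exact h2.2) h2.1
        simp [h3, h1]
  obtain ⟨G, hG, hGA, hGf⟩ := hA (f ∘ q) (hf.comp hq.continuousOn hqf) (hfA.comp hqf)
  refine ⟨G ∘ p, hG.comp hp.continuousOn hpb, hGA.comp hpb, fun x hx => ?_⟩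
  simp only [Function.comp_apply, hGf (hpf hx), hqp x hx.1]

/-- Cell-by-cell extension of a map carried by `Φ`. -/
theorem exists_extension_grid {T : Type*} [TopologicalSpace T] [DecidableEq (GridCell D)]
    {Φ : GridCell D → Set T} (hΦ : Monotone Φ) (E : Finset (GridCell D)) :
    ∀ (C : Finset (GridCell D)), FaceClosed C → FaceClosed (C ∪ E) → (∀ c ∈ E, c.IsUnit) →
      (∀ c ∈ E, CubeExtension {i // c.lo i < c.hi i} (Φ c)) → ∀ f : (D → ℝ) → T,
      ContinuousOn f (support C) → (∀ x ∈ support C, f x ∈ Φ (ofPoint x)) →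
      ∃ F : (D → ℝ) → T, ContinuousOn F (support (C ∪ E)) ∧
        (∀ x ∈ support (C ∪ E), F x ∈ Φ (ofPoint x)) ∧ Set.EqOn F f (support C) := by
  classical
  induction E using Finset.strongInduction with
  | H E ih =>
  intro C hC hCE hunit hext f hf hfΦ
  by_cases hEC : E ⊆ C
  · rw [Finset.union_eq_left.2 hEC]
    exact ⟨f, hf, hfΦ, fun _ _ => rfl⟩
  have hne : (E \ C).Nonempty := Finset.sdiff_nonempty.2 hEC
  -- All proper faces of a minimal missing cell are already in `C`, so the map is given on its whole
  -- boundary.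
  obtain ⟨c, hcmin⟩ := (E \ C).exists_minimal hne
  obtain ⟨hcE, hcC⟩ := Finset.mem_sdiff.1 hcmin.1
  have hface (x : D → ℝ) (hx : x ∈ c.box) (hxc : ofPoint x ≠ c) : ofPoint x ∈ C := by
    by_contra hxC
    have hxE : ofPoint x ∈ E \ C := Finset.mem_sdiff.2
      ⟨(Finset.mem_union.1 (hCE c (Finset.mem_union_right _ hcE) x hx)).resolve_left hxC, hxC⟩
    exact hxc (le_antisymm (ofPoint_le_iff.2 hx) (hcmin.2 hxE (ofPoint_le_iff.2 hx)))
  have hsub : c.box ∩ {x | ofPoint x ≠ c} ⊆ support C := fun x hx => hface x hx.1 hx.2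
  obtain ⟨G, hG, hGΦ, hGf⟩ := exists_extension_box (hunit c hcE) (hext c hcE) (hf.mono hsub)
    fun x hx => hΦ (ofPoint_le_iff.2 hx.1) (hfΦ x (hsub hx))
  let f' : (D → ℝ) → T := fun x => if ofPoint x ∈ C then f x else G x
  have hf'C : Set.EqOn f' f (support C) := fun x hx => if_pos hx
  have hf'c : Set.EqOn f' G c.box := by
    intro x hx
    by_cases hxC : ofPoint x ∈ C
    · simp only [f', if_pos hxC]
      exact (hGf ⟨hx, fun h => hcC (h ▸ hxC)⟩).symm
    · simp only [f', if_neg hxC]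
  have hsupp : support (insert c C) = support C ∪ c.box := by
    ext x
    simp only [support, Finset.mem_insert, Set.mem_ofPred_eq, Set.mem_union]
    constructor
    · rintro (h | h)
      · exact Or.inr (h ▸ mem_box_ofPoint x)
      · exact Or.inl h
    · rintro (h | h)
      · exact Or.inr h
      · by_cases hxc : ofPoint x = c
        · exact Or.inl hxc
        · exact Or.inr (hface x h hxc)
  have hunion : insert c C ∪ E.erase c = C ∪ E := by
    ext d
    simp only [Finset.mem_union, Finset.mem_insert, Finset.mem_erase]
    by_cases hd : d = c
    · simp [hd, hcE]
    · simp [hd]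
  obtain ⟨F, hF, hFΦ, hFf⟩ := ih (E.erase c) (Finset.erase_ssubset hcE) (insert c C)
    (by
      intro d hd x hx
      rcases Finset.mem_insert.1 hd with rfl | hd
      · by_cases hxc : ofPoint x = d
        · exact hxc ▸ Finset.mem_insert_self _ _
        · exact Finset.mem_insert_of_mem (hface x hx hxc)
      · exact Finset.mem_insert_of_mem (hC d hd x hx))
    (hunion ▸ hCE) (fun d hd => hunit d (Finset.mem_of_mem_erase hd))
    (fun d hd => hext d (Finset.mem_of_mem_erase hd)) f'
    (by
      rw [hsupp]
      exact (hf.congr hf'C).union_of_isClosed (hG.congr hf'c) hC.isClosed_support c.isClosed_box)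
    (by
      intro x hx
      by_cases hxC : ofPoint x ∈ C
      · rw [hf'C hxC]
        exact hfΦ x hxC
      · have hxc : ofPoint x = c := (Finset.mem_insert.1 hx).resolve_right hxC
        have hxb : x ∈ c.box := hxc ▸ mem_box_ofPoint x
        rw [hf'c hxb, hxc]
        exact hGΦ hxb)
  rw [hunion] at hF hFΦ
  exact ⟨F, hF, hFΦ, fun x hx => (hFf (Finset.mem_insert_of_mem hx)).trans (hf'C hx)⟩

end GridCell

/-! ### Connectivity of a union of two open sets -/

namespace GridCell

/-- The boundary of the cube `[0, N]^ι`. -/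
def cubeBoundary (ι : Type*) (N : ℕ) : Set (ι → ℝ) :=
  {x | (∀ i, 0 ≤ x i ∧ x i ≤ N) ∧ ∃ i, x i = 0 ∨ x i = N}

/-- The cells of `∂[0, N]^ι × [0, 1]`. -/
def IsWallCell {ι : Type*} (N : ℕ) (c : GridCell (Option ι)) : Prop :=
  c.IsUnit ∧ (∀ i, 0 ≤ c.lo (some i) ∧ c.hi (some i) ≤ N) ∧ 0 ≤ c.lo none ∧ c.hi none ≤ 1 ∧
    ∃ i, (c.lo (some i) = 0 ∧ c.hi (some i) = 0) ∨ (c.lo (some i) = N ∧ c.hi (some i) = N)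

theorem finite_isWallCell (ι : Type*) [Fintype ι] (N : ℕ) :
    {c : GridCell (Option ι) | IsWallCell N c}.Finite := by
  classical
  let b : Option ι → ℤ := fun _ => max N 1
  have hfin : (Set.Icc (0 : Option ι → ℤ) b).Finite := Set.finite_Icc _ _
  refine ((hfin.image OrderDual.toDual).prod hfin).subset fun (c : GridCell _) hc => ?_
  obtain ⟨h1, h2, h3, h4, -⟩ := hc
  have key : ∀ i, 0 ≤ c.lo i ∧ c.hi i ≤ b i := by
    rintro (_ | i)
    · exact ⟨h3, h4.trans (le_max_right _ _)⟩
    · exact ⟨(h2 i).1, (h2 i).2.trans (le_max_left _ _)⟩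
  exact ⟨⟨c.lo, ⟨fun i => (key i).1, fun i => (h1 i).1.trans (key i).2⟩, rfl⟩,
    ⟨fun i => (key i).1.trans (h1 i).1, fun i => (key i).2⟩⟩

theorem isWallCell_ofPoint {ι : Type*} {N : ℕ} {x : Option ι → ℝ} :
    IsWallCell N (ofPoint x) ↔
      (fun i => x (some i)) ∈ cubeBoundary ι N ∧ 0 ≤ x none ∧ x none ≤ 1 := by
  have h0 (y : ℝ) : ⌊y⌋ = 0 ∧ ⌈y⌉ = 0 ↔ y = 0 := by
    refine ⟨fun ⟨h1, h2⟩ => le_antisymm ?_ ?_, fun h => by simp [h]⟩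
    · simpa [h2] using Int.le_ceil y
    · simpa [h1] using Int.floor_le y
  have hN (y : ℝ) : ⌊y⌋ = (N : ℤ) ∧ ⌈y⌉ = (N : ℤ) ↔ y = N := by
    refine ⟨fun ⟨h1, h2⟩ => le_antisymm ?_ ?_, fun h => by simp [h]⟩
    · simpa [h2] using Int.le_ceil y
    · simpa [h1] using Int.floor_le y
  simp only [IsWallCell, isUnit_ofPoint, lo_ofPoint, hi_ofPoint, h0, hN, true_and, cubeBoundary,
    Set.mem_ofPred_eq, Int.le_floor, Int.ceil_le]
  push_cast
  constructor
  · rintro ⟨h1, h2, h3, h4⟩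
    exact ⟨⟨h1, h4⟩, h2, h3⟩
  · rintro ⟨⟨h1, h4⟩, h2, h3⟩
    exact ⟨h1, h2, h3, h4⟩

theorem IsWallCell.of_le {ι : Type*} {N : ℕ} {c : GridCell (Option ι)} (hc : IsWallCell N c)
    {x : Option ι → ℝ} (hx : x ∈ c.box) : IsWallCell N (ofPoint x) := by
  rw [isWallCell_ofPoint]
  obtain ⟨-, h2, h3, h4, j, hj⟩ := hc
  have hl (i) : (c.lo i : ℝ) ≤ x i := (hx i).1
  have hh (i) : x i ≤ (c.hi i : ℝ) := (hx i).2
  refine ⟨⟨fun i => ⟨?_, ?_⟩, j, ?_⟩, ?_, ?_⟩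
  · exact le_trans (by exact_mod_cast (h2 i).1) (hl (some i))
  · exact (hh (some i)).trans (by exact_mod_cast (h2 i).2)
  · have h5 := hl (some j)
    have h6 := hh (some j)
    rcases hj with ⟨h, h'⟩ | ⟨h, h'⟩ <;> rw [h] at h5 <;> rw [h'] at h6
    · left; push_cast at h5 h6; linarith
    · right; push_cast at h5 h6; linarith
  · exact le_trans (by exact_mod_cast h3) (hl none)
  · exact (hh none).trans (by exact_mod_cast h4)

/-- A map on `∂[0, N]^ι` that sends small cells into `U` or into `V` can be deformed into `U`. -/
theorem exists_deformation {T ι : Type*} [TopologicalSpace T] [Fintype ι] {U V : Set T} {m : ℤ}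
    (hV : IsNConnected m V) (hUV : IsNConnected (m - 1) (U ∩ V : Set T))
    (hι : (Fintype.card ι : ℤ) ≤ m + 1) {N : ℕ} {f : (ι → ℝ) → T}
    (hf : ContinuousOn f (cubeBoundary ι N))
    (hsmall : ∀ c : GridCell (Option ι), IsWallCell N c →
      (∀ x ∈ c.box, f (fun i => x (some i)) ∈ U) ∨ ∀ x ∈ c.box, f (fun i => x (some i)) ∈ V) :
    ∃ H : (Option ι → ℝ) → T,
      ContinuousOn H {x | (fun i => x (some i)) ∈ cubeBoundary ι N ∧ 0 ≤ x none ∧ x none ≤ 1} ∧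
      (∀ x, (fun i => x (some i)) ∈ cubeBoundary ι N → x none = 0 →
        H x = f fun i => x (some i)) ∧
      ∀ x, (fun i => x (some i)) ∈ cubeBoundary ι N → x none = 1 → H x ∈ U := by
  classical
  let pU : GridCell (Option ι) → Prop := fun c => ∀ x ∈ c.box, f (fun i => x (some i)) ∈ U
  let pV : GridCell (Option ι) → Prop := fun c => ∀ x ∈ c.box, f (fun i => x (some i)) ∈ V
  let W : Finset (GridCell (Option ι)) := (finite_isWallCell ι N).toFinset
  -- The coordinate `none` is time. The homotopy is stationary on the cells of `C`: those that `f`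
  -- already sends into `U`, and those at time `0`. It has to be constructed on `E`.
  let C : Finset (GridCell (Option ι)) := W.filter fun c => pU c ∨ c.hi none ≤ 0
  let E : Finset (GridCell (Option ι)) := W.filter fun c => ¬(pU c ∨ c.hi none ≤ 0)
  have hW {c} : c ∈ W ↔ IsWallCell N c := by simp [W]
  have hCE : C ∪ E = W := Finset.filter_union_filter_not_eq _ _
  -- The carrier records where a cell may go: it stays in `U` or `V` if `f` sends it there, and
  -- cells at time `1` must land in `U`. A larger cell meets fewer of these conditions, hence
  -- monotonicity.
  let Φ : GridCell (Option ι) → Set T := fun c =>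
    {y | (pU c → y ∈ U) ∧ (pV c → y ∈ V) ∧ (1 ≤ c.lo none → y ∈ U)}
  have hΦ : Monotone Φ := by
    intro c c' h y hy
    refine ⟨fun hc' => hy.1 fun x hx => hc' x (box_mono h hx),
      fun hc' => hy.2.1 fun x hx => hc' x (box_mono h hx), fun hc' => hy.2.2 ?_⟩
    exact hc'.trans ((le_iff.1 h).1 none)
  have hWf : FaceClosed W := fun c hc x hx => hW.2 ((hW.1 hc).of_le hx)
  have hCf : FaceClosed C := by
    intro c hc x hx
    obtain ⟨hcW, hc'⟩ := Finset.mem_filter.1 hc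
    have hle := ofPoint_le_iff.2 hx
    refine Finset.mem_filter.2 ⟨hWf c hcW x hx, hc'.imp (fun h y hy => h y (box_mono hle hy))
      fun h => ((le_iff.1 hle).2 none).trans h⟩
  have hsW : support W =
      {x | (fun i => x (some i)) ∈ cubeBoundary ι N ∧ 0 ≤ x none ∧ x none ≤ 1} := by
    ext x
    simp only [support, Set.mem_ofPred_eq, hW, isWallCell_ofPoint]
  have hsC : support C ⊆ support W := fun x hx => (Finset.mem_filter.1 hx).1
  have hext : ∀ c ∈ E, CubeExtension {i // c.lo i < c.hi i} (Φ c) := by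
    intro c hc
    obtain ⟨hcW, hc'⟩ := Finset.mem_filter.1 hc
    push Not at hc'
    obtain ⟨hpU, htop⟩ := hc'
    have hpV : pV c := (hsmall c (hW.1 hcW)).resolve_left hpU
    obtain ⟨h1, h2, h3, h4, j, hj⟩ := hW.1 hcW
    -- A wall cell is degenerate in direction `j`, so its dimension is at most `card ι ≤ m + 1`,
    -- which suits `V`. At time `1` it is also degenerate in time, and the dimension drops to at
    -- most `m`, which suits `U ∩ V`.
    have hj' : ¬ c.lo (some j) < c.hi (some j) := by omega
    by_cases ht : 1 ≤ c.lo none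
    · have hΦc : Φ c = U ∩ V := by
        ext y
        exact ⟨fun hy => ⟨hy.2.2 ht, hy.2.1 hpV⟩, fun hy => ⟨fun _ => hy.1, fun _ => hy.2,
          fun _ => hy.1⟩⟩
      rw [hΦc]
      refine hUV.cubeExtension _ ?_
      have hcard : Fintype.card {i // c.lo i < c.hi i} < Fintype.card ι := by
        have hn : ¬ c.lo none < c.hi none := by have := h1 none; omega
        have hs (i : {i // c.lo i < c.hi i}) : i.1.isSome := by
          rcases i with ⟨_ | i, hi⟩
          · exact absurd hi hn
          · rfl
        refine Fintype.card_lt_of_injective_of_notMem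
          (fun i : {i // c.lo i < c.hi i} => i.1.get (hs i)) (fun a b hab => ?_) (b := j) ?_
        · exact Subtype.ext (Option.get_inj.1 hab)
        · rintro ⟨i, hi⟩
          apply hj'
          have : i.1 = some j := by rw [← hi]; simp
          rw [← this]
          exact i.2
      omega
    · have hΦc : Φ c = V := by
        ext y
        exact ⟨fun hy => hy.2.1 hpV, fun hy => ⟨fun h => absurd h hpU, fun _ => hy,
          fun h => absurd h ht⟩⟩
      rw [hΦc]
      refine hV.cubeExtension _ ?_
      have hcard : Fintype.card {i // c.lo i < c.hi i} < Fintype.card (Option ι) :=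
        Fintype.card_subtype_lt hj'
      rw [Fintype.card_option] at hcard
      omega
  obtain ⟨H, hH, hHΦ, hHf⟩ := exists_extension_grid hΦ E C hCf (hCE ▸ hWf)
    (fun c hc => (hW.1 (Finset.mem_filter.1 hc).1).1) hext (fun x => f fun i => x (some i))
    (hf.comp (by fun_prop) fun x hx => by
      have := hsC hx
      rw [hsW] at this
      exact this.1)
    (by
      intro x hx
      obtain ⟨hxW, hx'⟩ := Finset.mem_filter.1 hx
      refine ⟨fun h => h x (mem_box_ofPoint x), fun h => h x (mem_box_ofPoint x), fun h => ?_⟩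
      have h1 : (ofPoint x).lo none ≤ (ofPoint x).hi none := (isUnit_ofPoint x none).1
      have hpU : pU (ofPoint x) := hx'.resolve_right (by omega)
      exact hpU x (mem_box_ofPoint x))
  rw [hCE, hsW] at hH
  rw [hCE, hsW] at hHΦ
  refine ⟨H, hH, fun x hx hx0 => hHf (Finset.mem_filter.2 ⟨?_, Or.inr ?_⟩), fun x hx hx1 => ?_⟩
  · rw [hW, isWallCell_ofPoint]
    exact ⟨hx, hx0.ge, by rw [hx0]; norm_num⟩
  · simp [hx0]
  · refine (hHΦ x ⟨hx, by rw [hx1]; norm_num, hx1.le⟩).2.2 ?_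
    simp [hx1]

end GridCell

open GridCell in
/-- A union of two open `m`-connected sets with `(m-1)`-connected intersection is
`m`-connected. -/
theorem IsNConnected.of_open_cover {T : Type*} [TopologicalSpace T] {U V : Set T} {m : ℤ}
    (hUo : IsOpen U) (hVo : IsOpen V) (hcover : U ∪ V = Set.univ) (hU : IsNConnected m U)
    (hV : IsNConnected m V) (hUV : IsNConnected (m - 1) (U ∩ V : Set T)) : IsNConnected m T := by
  refine ⟨fun hm => (hU.1 hm).map Subtype.val, fun k hk f => ?_⟩
  let ι := Fin (k + 1)
  obtain ⟨h, hh⟩ := exists_homeomorph_sphere_cubeFrontier ι k (by simp [ι])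
  have hmem (z : Metric.sphere (0 : EuclideanSpace ℝ (Fin (k + 1))) 1) : h z.1 ∈ cubeFrontier ι :=
    (hh z.1).1 z.2
  have hmem' {x} (hx : x ∈ cubeFrontier ι) : h.symm x ∈ Metric.sphere 0 1 :=
    (hh _).2 (by simpa using hx)
  obtain ⟨z0⟩ : Nonempty (Metric.sphere (0 : EuclideanSpace ℝ (Fin (k + 1))) 1) :=
    (NormedSpace.sphere_nonempty.2 zero_le_one).to_subtype
  classical
  -- The value `f z0` off the boundary of the cube is arbitrary; only the restriction to the
  -- boundary matters.
  let g : (ι → ℝ) → T := fun x => if hx : x ∈ cubeFrontier ι then f ⟨h.symm x, hmem' hx⟩ else f z0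
  have hg : ContinuousOn g (cubeFrontier ι) := by
    rw [continuousOn_iff_continuous_domRestrict]
    have : Set.domRestrict (cubeFrontier ι) g = fun x => f ⟨h.symm x.1, hmem' x.2⟩ := by
      ext x
      exact dif_pos x.2
    rw [this]
    fun_prop
  have hgf (z) : g (h z.1) = f z := by
    simp only [g, dif_pos (hmem z)]
    congr
    simp
  have hcomp : IsCompact (cubeFrontier ι) := by
    rw [← frontier_Icc_zero_one]
    exact isCompact_Icc.of_isClosed_subset isClosed_frontier isClosed_Icc.frontier_subset
  obtain ⟨OU, hOU, hOU'⟩ := continuousOn_iff'.1 hg U hUo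
  obtain ⟨OV, hOV, hOV'⟩ := continuousOn_iff'.1 hg V hVo
  obtain ⟨δ, hδ, hball⟩ := lebesgue_number_lemma_of_metric (c := fun b : Bool => cond b OU OV)
    hcomp (by rintro (_ | _) <;> assumption) (by
      intro x hx
      rcases (hcover ▸ Set.mem_univ (g x) : g x ∈ U ∪ V) with hx' | hx'
      · exact Set.mem_iUnion.2 ⟨true, (hOU' ▸ ⟨hx', hx⟩ : x ∈ OU ∩ cubeFrontier ι).1⟩
      · exact Set.mem_iUnion.2 ⟨false, (hOV' ▸ ⟨hx', hx⟩ : x ∈ OV ∩ cubeFrontier ι).1⟩)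
  obtain ⟨n, hn⟩ := exists_nat_one_div_lt hδ
  -- The cube is rescaled to `[0, N]^ι`. A unit cell then corresponds to side `1 / N < δ` in the sup
  -- metric, and the Lebesgue number puts its image into `U` or into `V`.
  let N : ℕ := n + 1
  have hN : (0 : ℝ) < N := by positivity
  have hNδ : 1 / (N : ℝ) < δ := by simpa [N] using hn
  have hscale {x : ι → ℝ} (hx : x ∈ cubeBoundary ι N) :
      (fun i => x i / N) ∈ cubeFrontier ι := by
    obtain ⟨h1, i, hi⟩ := hx
    refine ⟨⟨fun i => div_nonneg (h1 i).1 hN.le, fun i => (div_le_one hN).2 (h1 i).2⟩, i, ?_⟩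
    exact hi.imp (fun h => by simp [h]) fun h => by simp [h, hN.ne']
  have hscale' {x : ι → ℝ} (hx : x ∈ cubeFrontier ι) :
      (fun i => x i * N) ∈ cubeBoundary ι N := by
    obtain ⟨h1, i, hi⟩ := hx
    refine ⟨fun i => ⟨mul_nonneg (h1.1 i) hN.le, mul_le_of_le_one_left hN.le (h1.2 i)⟩, i, ?_⟩
    exact hi.imp (fun h => by simp [h]) fun h => by simp [h]
  have hsmall (c : GridCell (Option ι)) (hc : IsWallCell N c) :
      (∀ x ∈ c.box, g (fun i => x (some i) / N) ∈ U) ∨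
        ∀ x ∈ c.box, g (fun i => x (some i) / N) ∈ V := by
    have hbd {x} (hx : x ∈ c.box) : (fun i => x (some i) / N) ∈ cubeFrontier ι :=
      hscale (isWallCell_ofPoint.1 (hc.of_le hx)).1
    have hlo : (fun i => (c.lo i : ℝ)) ∈ c.box := fun i =>
      ⟨le_rfl, Int.cast_le.2 (hc.1 i).1⟩
    obtain ⟨b, hb⟩ := hball _ (hbd hlo)
    have key {x} (hx : x ∈ c.box) : (fun i => x (some i) / N) ∈ cond b OU OV := by
      refine hb ?_
      refine lt_of_le_of_lt ((dist_pi_le_iff (by positivity)).2 fun i => ?_) hNδ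
      rw [Real.dist_eq, ← sub_div, abs_div, abs_of_pos hN]
      gcongr
      have h1 := hx (some i)
      have h2 : (c.hi (some i) : ℝ) ≤ c.lo (some i) + 1 := by exact_mod_cast (hc.1 (some i)).2
      rw [abs_le]
      constructor <;> linarith
    cases b
    · exact Or.inr fun x hx => (hOV' ▸ ⟨key hx, hbd hx⟩ : _ ∈ g ⁻¹' V ∩ cubeFrontier ι).1
    · exact Or.inl fun x hx => (hOU' ▸ ⟨key hx, hbd hx⟩ : _ ∈ g ⁻¹' U ∩ cubeFrontier ι).1
  obtain ⟨H, hH, hH0, hH1⟩ := exists_deformation hV hUV (ι := ι) (by simp [ι]; omega)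
    (f := fun x => g fun i => x i / N)
    (hg.comp (by fun_prop) fun x hx => hscale hx) hsmall
  let e : unitInterval × Metric.sphere (0 : EuclideanSpace ℝ (Fin (k + 1))) 1 → Option ι → ℝ :=
    fun p i => i.elim (p.1 : ℝ) fun i => h p.2.1 i * N
  have he : Continuous e := by
    refine continuous_pi fun i => ?_
    cases i
    · simp only [e, Option.elim_none]; fun_prop
    · simp only [e, Option.elim_some]; fun_prop
  have hem (p) : (fun i => e p (some i)) ∈ cubeBoundary ι N := hscale' (hmem p.2)
  let f1 : C(Metric.sphere (0 : EuclideanSpace ℝ (Fin (k + 1))) 1, U) :=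
    ⟨fun z => ⟨H (e (1, z)), hH1 _ (hem (1, z)) (by simp [e])⟩, Continuous.subtype_mk
      (hH.comp_continuous (by fun_prop) fun z => ⟨hem (1, z), by simp [e], by simp [e]⟩) _⟩
  -- Once deformed into `U`, the sphere contracts there.
  obtain ⟨y, hy⟩ := (hU.2 k hk f1).comp_right ⟨Subtype.val, continuous_subtype_val⟩
  refine ⟨y, ContinuousMap.Homotopic.trans ⟨?_⟩ hy⟩
  refine ⟨⟨fun p => H (e p), hH.comp_continuous he fun p => ⟨hem p, p.1.2.1, p.1.2.2⟩⟩,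
    fun z => ?_, fun z => rfl⟩
  change H (e (0, z)) = f z
  rw [hH0 _ (hem _) (by simp [e]), ← hgf]
  congr
  ext i
  simp [e, hN.ne']

/-! ### Maps into and out of geometric realizations -/

namespace PreAbstractSimplicialComplex

theorem face_mono {V : Type*} {K : PreAbstractSimplicialComplex V} {s t : Finset V}
    (hs : s ∈ K.faces) (hts : t ⊆ s) (ht : t.Nonempty) : t ∈ K.faces :=
  (K.isRelLowerSet_faces hs).2 hts ht

theorem face_nonempty {V : Type*} {K : PreAbstractSimplicialComplex V} {s : Finset V}
    (hs : s ∈ K.faces) : s.Nonempty :=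
  (K.isRelLowerSet_faces hs).1

/-- The largest `t` such that `x - t b` has nonnegative coordinates, where `b` is the barycenter
of `σ`. -/
noncomputable def barycenterWeight {V : Type*} (σ : Finset V) (hσ : σ.Nonempty) (x : V → ℝ) : ℝ :=
  σ.card * σ.inf' hσ x

namespace Realization

variable {V V' : Type*} {K : PreAbstractSimplicialComplex V} {K' : PreAbstractSimplicialComplex V'}

theorem nonneg (x : K.Realization) (v : V) : 0 ≤ x.1 v := by
  obtain ⟨s, -, hx⟩ := x.2
  exact hx.1 v

theorem exists_carrier (x : K.Realization) : ∃ s ∈ K.faces, ∀ v, v ∈ s ↔ x.1 v ≠ 0 := by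
  classical
  obtain ⟨s, hs, h0, h1, h2⟩ := x.2
  refine ⟨s.filter fun v => x.1 v ≠ 0, face_mono hs (Finset.filter_subset _ _) ?_, fun v => ?_⟩
  · rw [← Finset.card_pos, Nat.pos_iff_ne_zero]
    intro h
    rw [Finset.card_eq_zero, Finset.filter_eq_empty_iff] at h
    rw [Finset.sum_eq_zero fun v hv => not_not.1 (h hv)] at h2
    exact zero_ne_one h2
  · rw [Finset.mem_filter, and_iff_right_iff_imp]
    exact fun h => not_not.1 fun hv => h (h1 v hv)

/-- The set of vertices with nonzero barycentric coordinate. -/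
noncomputable def carrier (x : K.Realization) : Finset V := x.exists_carrier.choose

theorem carrier_mem (x : K.Realization) : x.carrier ∈ K.faces := x.exists_carrier.choose_spec.1

theorem mem_carrier {x : K.Realization} {v : V} : v ∈ x.carrier ↔ x.1 v ≠ 0 :=
  x.exists_carrier.choose_spec.2 v

theorem sum_eq_one (x : K.Realization) {s : Finset V} (hs : ∀ v ∉ s, x.1 v = 0) :
    ∑ v ∈ s, x.1 v = 1 := by
  have key (t : Finset V) (ht : ∀ v ∉ t, x.1 v = 0) : ∑ v ∈ t, x.1 v = ∑ v ∈ x.carrier, x.1 v :=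
    (Finset.sum_subset (fun v hv => not_not.1 fun hvt => mem_carrier.1 hv (ht v hvt))
      fun v _ hv => not_not.1 fun h => hv (mem_carrier.2 h)).symm
  obtain ⟨t, -, -, h1, h2⟩ := x.2
  rw [key s hs, ← key t h1, h2]

theorem mem_geometricSimplex (x : K.Realization) {s : Finset V} (hs : ∀ v ∉ s, x.1 v = 0) :
    x.1 ∈ geometricSimplex s :=
  ⟨x.nonneg, hs, x.sum_eq_one hs⟩

theorem carrier_subset {x : K.Realization} {s : Finset V} (hs : ∀ v ∉ s, x.1 v = 0) :
    x.carrier ⊆ s := fun v hv => not_not.1 fun h => mem_carrier.1 hv (hs v h)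

theorem eq_zero_of_notMem_carrier {x : K.Realization} {v : V} (hv : v ∉ x.carrier) :
    x.1 v = 0 := not_not.1 fun h => hv (mem_carrier.2 h)

theorem continuous_dom {X : Type*} [TopologicalSpace X] {g : K.Realization → X} :
    Continuous g ↔ ∀ s : K.faces, Continuous (g ∘ K.faceInclusion s) := by
  rw [continuous_iSup_dom]
  exact forall_congr' fun s => continuous_coinduced_dom

theorem continuous_faceInclusion (s : K.faces) : Continuous (K.faceInclusion s) :=
  continuous_dom.1 continuous_id s

@[fun_prop]
theorem continuous_coord (v : V) : Continuous fun x : K.Realization => x.1 v :=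
  continuous_dom.2 fun _ => (continuous_apply v).comp continuous_subtype_val

/-- A coordinatewise continuous map supported on finitely many vertices is continuous. -/
theorem continuous_of_finite_support {Z : Type*} [TopologicalSpace Z] {g : Z → K.Realization}
    (T : Finset V) (hT : ∀ z, ∀ v ∉ T, (g z).1 v = 0) (hg : ∀ v, Continuous fun z => (g z).1 v) :
    Continuous g := by
  have hval : Continuous fun z => (g z).1 := continuous_pi hg
  let ι := {s : K.faces // s.1 ⊆ T}
  have : Finite ι := by
    refine Finite.of_injective (β := T.powerset)
      (fun s => ⟨s.1.1, Finset.mem_powerset.2 s.2⟩) fun a b h => ?_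
    exact Subtype.ext (Subtype.ext (congrArg (fun s : T.powerset => s.1) h))
  -- Finitely many closed sets cover `Z`, one for each face inside `T`. On each of them `g` factors
  -- through a single closed simplex, where continuity is coordinatewise.
  let A : ι → Set Z := fun s => {z | ∀ v ∉ s.1.1, (g z).1 v = 0}
  refine LocallyFinite.continuous (f := A) (locallyFinite_of_finite _) ?_ ?_ ?_
  · refine Set.eq_univ_of_forall fun z => Set.mem_iUnion.2
      ⟨⟨⟨(g z).carrier, (g z).carrier_mem⟩, carrier_subset (hT z)⟩, ?_⟩
    exact fun v hv => eq_zero_of_notMem_carrier hv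
  · intro s
    simp only [A, Set.ofPred_forall]
    exact isClosed_iInter fun v => isClosed_iInter fun _ => isClosed_eq (hg v) continuous_const
  · intro s
    rw [continuousOn_iff_continuous_domRestrict]
    have : Set.domRestrict (A s) g = fun z => K.faceInclusion s.1
        ⟨(g z.1).1, (g z.1).mem_geometricSimplex z.2⟩ := rfl
    rw [this]
    exact (continuous_faceInclusion s.1).comp
      (Continuous.subtype_mk (hval.comp continuous_subtype_val) _)

/-- A coordinatewise continuous map that sends faces to finite unions of faces is continuous. -/
theorem continuous_of_coord {g : K.Realization → K'.Realization}
    (hT : ∀ s ∈ K.faces, ∃ T : Finset V', ∀ x : K.Realization, (∀ v ∉ s, x.1 v = 0) →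
      ∀ w ∉ T, (g x).1 w = 0) (hg : ∀ w, Continuous fun x => (g x).1 w) : Continuous g := by
  refine continuous_dom.2 fun s => ?_
  obtain ⟨T, hT⟩ := hT s.1 s.2
  exact continuous_of_finite_support T (fun z => hT _ z.2.2.1)
    fun w => (hg w).comp (continuous_faceInclusion s)

/-- Otherwise there are distinct vertices `e n` and points `z n` for which `f (z n)` has nonzero
coordinate at `e n`. The function `φ`, linear on every face with value `n` divided by that
coordinate at `e n`, is continuous in the weak topology, yet at least `n` at `f (z n)`,
contradicting compactness. -/
theorem exists_finite_support {Z : Type*} [TopologicalSpace Z] [CompactSpace Z]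
    (f : C(Z, K.Realization)) : ∃ T : Finset V, ∀ z, ∀ v ∉ T, (f z).1 v = 0 := by
  classical
  let S : Set V := {v | ∃ z, (f z).1 v ≠ 0}
  by_cases hS : S.Finite
  · exact ⟨hS.toFinset, fun z v hv => not_not.1 fun h => hv (hS.mem_toFinset.2 ⟨z, h⟩)⟩
  exfalso
  have hinf : Infinite S := Set.infinite_coe_iff.2 hS
  let e : ℕ ↪ S := Infinite.natEmbedding S
  choose z hz using fun n => (e n).2
  let c : V → ℝ := fun v => if h : ∃ n, (e n : V) = v then h.choose / (f (z h.choose)).1 v else 0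
  have hcn (n : ℕ) : c (e n) = n / (f (z n)).1 (e n) := by
    have h : ∃ m, (e m : V) = e n := ⟨n, rfl⟩
    have h' : h.choose = n := e.injective (Subtype.ext h.choose_spec)
    simp only [c, dif_pos h]
    rw [h']
  have hc0 (v : V) : 0 ≤ c v := by
    simp only [c]
    split_ifs with h
    · exact div_nonneg (Nat.cast_nonneg _) (nonneg _ _)
    · exact le_rfl
  let φ : K.Realization → ℝ := fun x => ∑ v ∈ x.carrier, c v * x.1 v
  have hφ : Continuous φ := by
    refine continuous_dom.2 fun s => ?_
    have : φ ∘ K.faceInclusion s = fun x => ∑ v ∈ s.1, c v * x.1 v := by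
      ext x
      refine Finset.sum_subset (carrier_subset x.2.2.1) fun v _ hv => ?_
      rw [eq_zero_of_notMem_carrier hv, mul_zero]
    rw [this]
    exact continuous_finsetSum _ fun v _ =>
      continuous_const.mul ((continuous_apply v).comp continuous_subtype_val)
  obtain ⟨M, hM⟩ := (isCompact_range (hφ.comp f.continuous)).bddAbove
  obtain ⟨n, hn⟩ := exists_nat_gt M
  have h1 : φ (f (z n)) ≤ M := hM ⟨z n, rfl⟩
  have h2 : c (e n) * (f (z n)).1 (e n) ≤ φ (f (z n)) :=
    Finset.single_le_sum (f := fun v => c v * (f (z n)).1 v)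
      (fun v _ => mul_nonneg (hc0 v) (nonneg _ _)) (mem_carrier.2 (hz n))
  rw [hcn, div_mul_cancel₀ _ (hz n)] at h2
  linarith

/-- The point `(1 - t) x + t y` for two points `x`, `y` of a common face. -/
theorem exists_segment {x y : K.Realization} {s : Finset V} (hs : s ∈ K.faces)
    (hx : ∀ v ∉ s, x.1 v = 0) (hy : ∀ v ∉ s, y.1 v = 0) {t : ℝ} (h0 : 0 ≤ t) (h1 : t ≤ 1) :
    ∃ s ∈ K.faces, (fun v => (1 - t) * x.1 v + t * y.1 v) ∈ geometricSimplex s := by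
  refine ⟨s, hs, fun v => ?_, fun v hv => ?_, ?_⟩
  · have := x.nonneg v
    have := y.nonneg v
    have := sub_nonneg.2 h1
    positivity
  · simp [hx v hv, hy v hv]
  · rw [Finset.sum_add_distrib, ← Finset.mul_sum, ← Finset.mul_sum, x.sum_eq_one hx,
      y.sum_eq_one hy]
    ring

/-- Contiguous maps are homotopic along straight lines. -/
theorem exists_straightLine_homotopy {Z : Type*} [TopologicalSpace Z] [CompactSpace Z]
    (f g : C(Z, K.Realization))
    (h : ∀ z, ∃ s ∈ K.faces, (∀ v ∉ s, (f z).1 v = 0) ∧ ∀ v ∉ s, (g z).1 v = 0) :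
    ∃ H : f.Homotopy g, ∀ t z v,
      (H (t, z)).1 v = (1 - (t : ℝ)) * (f z).1 v + (t : ℝ) * (g z).1 v := by
  classical
  let H : unitInterval × Z → K.Realization := fun p =>
    ⟨fun v => (1 - (p.1 : ℝ)) * (f p.2).1 v + (p.1 : ℝ) * (g p.2).1 v, by
      obtain ⟨s, hs, hf, hg⟩ := h p.2
      exact exists_segment hs hf hg p.1.2.1 p.1.2.2⟩
  obtain ⟨S, hS⟩ := exists_finite_support f
  obtain ⟨T, hT⟩ := exists_finite_support g
  have hf (v : V) : Continuous fun z => (f z).1 v := (continuous_coord v).comp f.continuous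
  have hg (v : V) : Continuous fun z => (g z).1 v := (continuous_coord v).comp g.continuous
  -- Joint continuity in time and space reduces to coordinates because compactness of `Z` bounds the
  -- vertices involved.
  have hH : Continuous H := by
    refine continuous_of_finite_support (S ∪ T) (fun p v hv => ?_) fun v => ?_
    · rw [Finset.mem_union, not_or] at hv
      simp [H, hS _ v hv.1, hT _ v hv.2]
    · have := (hf v).comp (continuous_snd (X := unitInterval))
      have := (hg v).comp (continuous_snd (X := unitInterval))
      simp only [H]
      fun_prop
  refine ⟨⟨⟨H, hH⟩, fun z => ?_, fun z => ?_⟩, fun t z v => rfl⟩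
  · exact Subtype.ext (funext fun v => by simp [H])
  · exact Subtype.ext (funext fun v => by simp [H])

section Map

variable [DecidableEq V']

/-- The map of realizations induced by a simplicial map. -/
noncomputable def map (φ : V → V') (hφ : ∀ s ∈ K.faces, s.image φ ∈ K'.faces)
    (x : K.Realization) : K'.Realization :=
  ⟨fun w => ∑ v ∈ x.carrier, if φ v = w then x.1 v else 0, x.carrier.image φ,
    hφ _ x.carrier_mem, fun w => Finset.sum_nonneg fun v _ => by
      split_ifs
      exacts [x.nonneg v, le_rfl], fun w hw => Finset.sum_eq_zero fun v hv => if_neg fun (h : φ v = w) =>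
      hw (h ▸ Finset.mem_image_of_mem φ hv), by
    rw [Finset.sum_comm, ← x.sum_eq_one fun v hv => eq_zero_of_notMem_carrier hv]
    refine Finset.sum_congr rfl fun v hv => ?_
    rw [Finset.sum_ite_eq, if_pos (Finset.mem_image_of_mem φ hv)]⟩

theorem map_apply (φ : V → V') (hφ : ∀ s ∈ K.faces, s.image φ ∈ K'.faces) (x : K.Realization)
    {s : Finset V} (hs : ∀ v ∉ s, x.1 v = 0) (w : V') :
    (map φ hφ x).1 w = ∑ v ∈ s, if φ v = w then x.1 v else 0 := by
  refine Finset.sum_subset (carrier_subset hs) fun v _ hv => ?_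
  rw [eq_zero_of_notMem_carrier hv, ite_self]

theorem continuous_map (φ : V → V') (hφ : ∀ s ∈ K.faces, s.image φ ∈ K'.faces) :
    Continuous (map φ hφ) := by
  refine continuous_of_coord (fun s _ => ⟨s.image φ, fun x hx w hw => ?_⟩) fun w => ?_
  · rw [map_apply φ hφ x hx]
    exact Finset.sum_eq_zero fun v hv => if_neg fun (h : φ v = w) => hw (h ▸ Finset.mem_image_of_mem φ hv)
  · refine continuous_dom.2 fun s => ?_
    have : (fun x => (map φ hφ x).1 w) ∘ K.faceInclusion s =
        fun x => ∑ v ∈ s.1, if φ v = w then x.1 v else 0 := by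
      ext x
      exact map_apply φ hφ _ x.2.2.1 w
    rw [this]
    refine continuous_finsetSum _ fun v _ => ?_
    split_ifs
    exacts [(continuous_apply v).comp continuous_subtype_val, continuous_const]

/-- Only coordinates are compared, since `K''` may differ from `K`; this covers an inclusion of a
subcomplex that factors through `K'`. -/
theorem map_map_eq {K'' : PreAbstractSimplicialComplex V} [DecidableEq V] (φ : V → V')
    (hφ : ∀ s ∈ K.faces, s.image φ ∈ K'.faces) (ψ : V' → V)
    (hψ : ∀ s ∈ K'.faces, s.image ψ ∈ K''.faces) (x : K.Realization)
    (h : ∀ v ∈ x.carrier, ψ (φ v) = v) : (map ψ hψ (map φ hφ x)).1 = x.1 := by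
  ext u
  have hx : ∀ v ∉ x.carrier, x.1 v = 0 := fun v hv => eq_zero_of_notMem_carrier hv
  have hs : ∀ w ∉ x.carrier.image φ, (map φ hφ x).1 w = 0 := fun w hw => by
    rw [map_apply φ hφ x hx]
    exact Finset.sum_eq_zero fun v hv => if_neg fun (h : φ v = w) => hw (h ▸ Finset.mem_image_of_mem φ hv)
  rw [map_apply ψ hψ _ hs]
  have : ∀ w, (if ψ w = u then (map φ hφ x).1 w else 0) =
      ∑ v ∈ x.carrier, if φ v = w then (if ψ w = u then x.1 v else 0) else 0 := by
    intro w
    split_ifs with hw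
    · exact map_apply φ hφ x hx w
    · simp
  simp_rw [this]
  rw [Finset.sum_comm]
  have h' : ∀ v ∈ x.carrier, (∑ w ∈ x.carrier.image φ,
      if φ v = w then (if ψ w = u then x.1 v else 0) else 0) = if v = u then x.1 v else 0 := by
    intro v hv
    rw [Finset.sum_ite_eq, if_pos (Finset.mem_image_of_mem φ hv), h v hv]
  rw [Finset.sum_congr rfl h', Finset.sum_ite_eq']
  split_ifs with hu
  · rfl
  · exact (hx u hu).symm

end Map

/-- A complex with a cone vertex is `m`-connected for all `m`. -/
theorem isNConnected_of_cone [DecidableEq V] (v₀ : V) (hv₀ : {v₀} ∈ K.faces)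
    (hcone : ∀ s ∈ K.faces, insert v₀ s ∈ K.faces) (m : ℤ) : IsNConnected m K.Realization := by
  let y : K.Realization := ⟨Pi.single v₀ 1, {v₀}, hv₀, fun v => by
    by_cases h : v = v₀
    · subst h; simp
    · simp [h], fun v hv => by simp_all, by simp⟩
  refine ⟨fun _ => ⟨y⟩, fun k _ f => ⟨y, ?_⟩⟩
  obtain ⟨H, -⟩ := exists_straightLine_homotopy f (ContinuousMap.const _ y) fun z =>
    ⟨insert v₀ (f z).carrier, hcone _ (f z).carrier_mem, fun v hv => by
      rw [Finset.mem_insert, not_or] at hv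
      exact eq_zero_of_notMem_carrier hv.2, fun v hv => by
      rw [Finset.mem_insert, not_or] at hv
      exact Pi.single_eq_of_ne hv.1 1⟩
  exact ⟨H⟩

/-- Connectivity is transported along simplicial maps that are mutually inverse on the vertices
of the target. -/
theorem isNConnected_of_retract [DecidableEq V] [DecidableEq V'] {m : ℤ}
    (hK : IsNConnected m K.Realization) (φ : V → V') (hφ : ∀ s ∈ K.faces, s.image φ ∈ K'.faces)
    (ψ : V' → V) (hψ : ∀ s ∈ K'.faces, s.image ψ ∈ K.faces)
    (h : ∀ s ∈ K'.faces, ∀ w ∈ s, φ (ψ w) = w) : IsNConnected m K'.Realization := by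
  refine ⟨fun hm => (hK.1 hm).map (map φ hφ), fun k hk f => ?_⟩
  have hnull := (hK.2 k hk ((⟨map ψ hψ, continuous_map ψ hψ⟩ : C(_, _)).comp f)).comp_right
    ⟨map φ hφ, continuous_map φ hφ⟩
  convert hnull using 1
  ext z : 1
  exact Subtype.ext (map_map_eq ψ hψ φ hφ (f z) (h _ (f z).carrier_mem)).symm

theorem barycenterWeight_nonneg {σ : Finset V} (hσ : σ.Nonempty) (x : K.Realization) : 0 ≤ barycenterWeight σ hσ x.1 :=
  mul_nonneg (Nat.cast_nonneg _) ((Finset.le_inf'_iff hσ _).2 fun v _ => x.nonneg v)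

theorem continuous_barycenterWeight {σ : Finset V} (hσ : σ.Nonempty) :
    Continuous fun x : K.Realization => barycenterWeight σ hσ x.1 := by
  unfold barycenterWeight
  exact continuous_const.mul (Continuous.finset_inf'_apply hσ fun v _ => continuous_coord v)

/-- If `ρ : P → M` and `j : M → P` are such that `j ∘ ρ` is contiguous to the identity along
straight lines in `P`, then `P` is as connected as `M`. -/
theorem isNConnected_of_straightLine {P : Set K.Realization} {M : PreAbstractSimplicialComplex V}
    {m : ℤ} (hM : IsNConnected m M.Realization) (j : C(M.Realization, P)) (ρ : P → M.Realization)
    (hρ : ∀ v, Continuous fun x => (ρ x).1 v) (hρ0 : ∀ (x : P) v, x.1.1 v = 0 → (ρ x).1 v = 0)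
    (hface : ∀ x : P, ∃ s ∈ K.faces, (∀ v ∉ s, x.1.1 v = 0) ∧ ∀ v ∉ s, (j (ρ x)).1.1 v = 0)
    (hseg : ∀ (x : P) (t : unitInterval) (y : K.Realization),
      (∀ v, y.1 v = (1 - (t : ℝ)) * x.1.1 v + (t : ℝ) * (j (ρ x)).1.1 v) → y ∈ P) :
    IsNConnected m P := by
  refine ⟨fun hm => (hM.1 hm).map j, fun k hk f => ?_⟩
  let val : C(P, K.Realization) := ⟨Subtype.val, continuous_subtype_val⟩
  obtain ⟨T, hT⟩ := exists_finite_support (val.comp f)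
  -- The map `ρ` is only assumed coordinatewise continuous; composed with `f` it has finite support
  -- and is therefore continuous.
  let g : C(Metric.sphere (0 : EuclideanSpace ℝ (Fin (k + 1))) 1, M.Realization) :=
    ⟨fun z => ρ (f z), continuous_of_finite_support T (fun z v hv => hρ0 _ _ (hT z v hv))
      fun v => (hρ v).comp f.continuous⟩
  obtain ⟨y, hy⟩ := (hM.2 k hk g).comp_right j
  obtain ⟨H, hH⟩ := exists_straightLine_homotopy (val.comp f) (val.comp (j.comp g))
    fun z => hface (f z)
  refine ⟨y, ContinuousMap.Homotopic.trans (g := j.comp g) ⟨?_⟩ hy⟩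
  refine ⟨⟨fun p => ⟨H p, hseg (f p.2) p.1 _ (hH p.1 p.2)⟩, H.continuous.subtype_mk _⟩,
    fun z => ?_, fun z => ?_⟩
  · exact Subtype.ext (H.apply_zero z)
  · exact Subtype.ext (H.apply_one z)

end Realization

end PreAbstractSimplicialComplex

/-! ### Radial projection and attaching the star of a simplex -/

namespace PreAbstractSimplicialComplex

variable {V : Type*} [DecidableEq V]

/-- The faces of `K` that do not contain `σ`. -/
def deletion (K : PreAbstractSimplicialComplex V) (σ : Finset V) :
    PreAbstractSimplicialComplex V where
  faces := {t | t ∈ K.faces ∧ ¬σ ⊆ t}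
  isRelLowerSet_faces := fun _ ht => ⟨face_nonempty ht.1, fun _ hr hne =>
    ⟨face_mono ht.1 hr hne, fun h => ht.2 (h.trans hr)⟩⟩

/-- The faces in the closed star of `σ` that do not contain `σ`. -/
def starBoundary (K : PreAbstractSimplicialComplex V) (σ : Finset V) :
    PreAbstractSimplicialComplex V where
  faces := {t | t ∈ K.faces ∧ ¬σ ⊆ t ∧ t ∪ σ ∈ K.faces}
  isRelLowerSet_faces := fun _ ht => ⟨face_nonempty ht.1, fun _ hr hne =>
    ⟨face_mono ht.1 hr hne, fun h => ht.2.1 (h.trans hr),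
      face_mono ht.2.2 (Finset.union_subset_union_left hr) (hne.mono Finset.subset_union_left)⟩⟩

/-- The coordinates of the barycenter of `σ`. -/
noncomputable def barycenter (σ : Finset V) (v : V) : ℝ := if v ∈ σ then (σ.card : ℝ)⁻¹ else 0

theorem barycenter_nonneg (σ : Finset V) (v : V) : 0 ≤ barycenter σ v := by
  unfold barycenter
  split_ifs <;> positivity

theorem barycenter_pos {σ : Finset V} {v : V} (hv : v ∈ σ) : 0 < barycenter σ v := by
  have := Finset.card_pos.2 ⟨v, hv⟩
  rw [barycenter, if_pos hv]
  positivity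

theorem barycenter_of_notMem {σ : Finset V} {v : V} (hv : v ∉ σ) : barycenter σ v = 0 := if_neg hv

theorem sum_barycenter {σ s : Finset V} (hσ : σ.Nonempty) (hs : σ ⊆ s) :
    ∑ v ∈ s, barycenter σ v = 1 := by
  have := Finset.card_pos.2 hσ
  simp only [barycenter, Finset.sum_ite_mem, Finset.inter_eq_right.2 hs, Finset.sum_const,
    nsmul_eq_mul]
  field_simp

/-- The radial projection from the barycenter of `σ`. -/
noncomputable def radialProjection (σ : Finset V) (hσ : σ.Nonempty) (x : V → ℝ) (v : V) : ℝ :=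
  (x v - barycenterWeight σ hσ x * barycenter σ v) / (1 - barycenterWeight σ hσ x)

namespace Realization

variable {K : PreAbstractSimplicialComplex V} {σ : Finset V}

theorem barycenterWeight_mul (hσ : σ.Nonempty) {v : V} (hv : v ∈ σ) (x : V → ℝ) :
    barycenterWeight σ hσ x * barycenter σ v = σ.inf' hσ x := by
  have := Finset.card_pos.2 hσ
  rw [barycenterWeight, barycenter, if_pos hv]
  field_simp

theorem barycenterWeight_mul_le (hσ : σ.Nonempty) (x : K.Realization) (v : V) :
    barycenterWeight σ hσ x.1 * barycenter σ v ≤ x.1 v := by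
  by_cases hv : v ∈ σ
  · rw [barycenterWeight_mul hσ hv]
    exact Finset.inf'_le _ hv
  · rw [barycenter_of_notMem hv, mul_zero]
    exact x.nonneg v

/-- With `w` the weight and `b` the barycenter, `x - w b` has nonnegative coordinates of sum `1 -
w`. If `w ≥ 1`, then `w = 1` and all of them vanish, so `x = b`. -/
theorem barycenterWeight_lt_one (hσ : σ.Nonempty) {x : K.Realization} (hx : x.1 ≠ barycenter σ) :
    barycenterWeight σ hσ x.1 < 1 := by
  by_contra! h
  apply hx
  have hs : ∀ v ∉ x.carrier ∪ σ, x.1 v = 0 := fun v hv =>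
    eq_zero_of_notMem_carrier fun h => hv (Finset.mem_union_left _ h)
  have hsum : ∑ v ∈ x.carrier ∪ σ, (x.1 v - barycenterWeight σ hσ x.1 * barycenter σ v) =
      1 - barycenterWeight σ hσ x.1 := by
    rw [Finset.sum_sub_distrib, ← Finset.mul_sum, x.sum_eq_one hs,
      sum_barycenter hσ Finset.subset_union_right, mul_one]
  have hnn : ∀ v ∈ x.carrier ∪ σ, 0 ≤ x.1 v - barycenterWeight σ hσ x.1 * barycenter σ v :=
    fun v _ => sub_nonneg.2 (barycenterWeight_mul_le hσ x v)
  have hone : barycenterWeight σ hσ x.1 = 1 := by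
    have := Finset.sum_nonneg hnn
    linarith
  rw [hone, sub_self] at hsum
  rw [hone] at hnn
  ext v
  by_cases hv : v ∈ x.carrier ∪ σ
  · have := (Finset.sum_eq_zero_iff_of_nonneg hnn).1 hsum v hv
    linarith
  · rw [hs v hv, barycenter_of_notMem fun h => hv (Finset.mem_union_right _ h)]

theorem radialProjection_eq_zero (hσ : σ.Nonempty) {x : K.Realization} {v : V} (hv : x.1 v = 0) :
    radialProjection σ hσ x.1 v = 0 := by
  have h1 := barycenterWeight_mul_le hσ x v
  have h2 := mul_nonneg (barycenterWeight_nonneg hσ x) (barycenter_nonneg σ v)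
  rw [radialProjection, hv, le_antisymm (hv ▸ h1) h2, sub_zero, zero_div]

theorem exists_radialProjection_eq_zero (hσ : σ.Nonempty) (x : V → ℝ) : ∃ v ∈ σ, radialProjection σ hσ x v = 0 := by
  obtain ⟨v, hv, h⟩ := σ.exists_mem_eq_inf' hσ x
  refine ⟨v, hv, ?_⟩
  rw [radialProjection, barycenterWeight_mul hσ hv, h, sub_self, zero_div]

theorem eq_radialProjection (hσ : σ.Nonempty) {x : K.Realization} (hx : x.1 ≠ barycenter σ) (v : V) :
    x.1 v = (1 - barycenterWeight σ hσ x.1) * radialProjection σ hσ x.1 v +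
      barycenterWeight σ hσ x.1 * barycenter σ v := by
  have : 1 - barycenterWeight σ hσ x.1 ≠ 0 := (sub_pos.2 (barycenterWeight_lt_one hσ hx)).ne'
  rw [radialProjection]
  field_simp
  ring

/-- The projection vanishes at a vertex `u` of `σ` with minimal coordinate; erasing `u` from the
carrier gives a face that no longer contains `σ`. -/
theorem exists_face_radialProjection (hσ : σ.Nonempty) {x : K.Realization} (hx : x.1 ≠ barycenter σ) :
    ∃ s ⊆ x.carrier, s.Nonempty ∧ ¬σ ⊆ s ∧ radialProjection σ hσ x.1 ∈ geometricSimplex s := by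
  obtain ⟨u, hu, hu0⟩ := exists_radialProjection_eq_zero hσ x.1
  have hlt := sub_pos.2 (barycenterWeight_lt_one hσ hx)
  have hcarr {v} (hv : v ∉ x.carrier) : radialProjection σ hσ x.1 v = 0 :=
    radialProjection_eq_zero hσ (eq_zero_of_notMem_carrier hv)
  have hs : ∀ v ∉ x.carrier.erase u, radialProjection σ hσ x.1 v = 0 := by
    intro v hv
    by_cases hvu : v = u
    · rw [hvu, hu0]
    · exact hcarr fun h => hv (Finset.mem_erase.2 ⟨hvu, h⟩)
  have hsum : ∑ v ∈ x.carrier.erase u, radialProjection σ hσ x.1 v = 1 := by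
    have h1 : ∑ v ∈ x.carrier.erase u, radialProjection σ hσ x.1 v =
        ∑ v ∈ x.carrier ∪ σ, radialProjection σ hσ x.1 v :=
      Finset.sum_subset ((Finset.erase_subset _ _).trans Finset.subset_union_left)
        fun v _ hv => hs v hv
    rw [h1]
    simp only [radialProjection]
    rw [← Finset.sum_div, Finset.sum_sub_distrib, ← Finset.mul_sum,
      sum_barycenter hσ Finset.subset_union_right, mul_one, x.sum_eq_one, div_self hlt.ne']
    exact fun v hv => eq_zero_of_notMem_carrier fun h => hv (Finset.mem_union_left _ h)
  refine ⟨x.carrier.erase u, Finset.erase_subset _ _, ?_, fun h => ?_, fun v => ?_, hs, hsum⟩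
  · rw [Finset.nonempty_iff_ne_empty]
    rintro h
    rw [h, Finset.sum_empty] at hsum
    exact zero_ne_one hsum
  · exact Finset.notMem_erase _ _ (h hu)
  · exact div_nonneg (sub_nonneg.2 (barycenterWeight_mul_le hσ x v)) hlt.le

theorem continuousOn_radialProjection (hσ : σ.Nonempty) (v : V) :
    ContinuousOn (fun x : K.Realization => radialProjection σ hσ x.1 v)
      {x | x.1 ≠ barycenter σ} := by
  have h1 := continuous_barycenterWeight (K := K) hσ
  have h2 := continuous_coord (K := K) v
  exact (h2.sub (h1.mul continuous_const)).continuousOn.div (continuous_const.sub h1).continuousOn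
    fun x hx => (sub_pos.2 (barycenterWeight_lt_one hσ hx)).ne'

/-- The point `(1 - t) y + t b` on the segment from `y` to the barycenter `b` of `σ`. -/
theorem exists_cone_point {M : PreAbstractSimplicialComplex V} (hσ : σ.Nonempty)
    (y : M.Realization) {s : Finset V} (hs : s ∈ K.faces) (hy : y.carrier ⊆ s) {t : ℝ} (h0 : 0 ≤ t)
    (h1 : t ≤ 1) (hσs : t = 0 ∨ σ ⊆ s) :
    ∃ s ∈ K.faces, (fun v => (1 - t) * y.1 v + t * barycenter σ v) ∈ geometricSimplex s := by
  have hy0 : ∀ v ∉ s, y.1 v = 0 := fun v hv => eq_zero_of_notMem_carrier fun h => hv (hy h)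
  refine ⟨s, hs, fun v => ?_, fun v hv => ?_, ?_⟩
  · have := y.nonneg v
    have := barycenter_nonneg σ v
    have := sub_nonneg.2 h1
    positivity
  · rcases hσs with h | h
    · simp [h, hy0 v hv]
    · simp [hy0 v hv, barycenter_of_notMem fun h' => hv (h h')]
  · rw [Finset.sum_add_distrib, ← Finset.mul_sum, ← Finset.mul_sum, y.sum_eq_one hy0]
    rcases hσs with h | h
    · simp [h]
    · rw [sum_barycenter hσ h]; ring

/-- The complement of the barycenter of `σ`, or its intersection with the open star of `σ`, is as
connected as a subcomplex onto which it projects radially. -/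
theorem isNConnected_of_radialProjection (hσ : σ.Nonempty) {P : Set K.Realization}
    {M : PreAbstractSimplicialComplex V} {m : ℤ} (hM : IsNConnected m M.Realization)
    {τ : ℝ} (hτ0 : 0 ≤ τ) (hτ1 : τ < 1)
    (hMK : ∀ t ∈ M.faces, ∃ s ∈ K.faces, t ⊆ s ∧ (τ = 0 ∨ σ ⊆ s)) (hMσ : ∀ t ∈ M.faces, ¬σ ⊆ t)
    (hP : ∀ x : K.Realization, x ∈ P ↔ x.1 ≠ barycenter σ ∧ (τ = 0 ∨ ∀ v ∈ σ, 0 < x.1 v))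
    (hPM : ∀ x ∈ P, ∀ s ⊆ x.carrier, s.Nonempty → ¬σ ⊆ s → s ∈ M.faces) :
    IsNConnected m P := by
  have hne {y : V → ℝ} {t : ℝ} (ht : t < 1) (h : ∃ v ∈ σ, y v = 0) :
      (fun v => (1 - t) * y v + t * barycenter σ v) ≠ barycenter σ := by
    obtain ⟨v, hv, hy⟩ := h
    intro h
    have h1 := congrFun h v
    have h2 := barycenter_pos hv
    simp only [hy, mul_zero, zero_add] at h1
    nlinarith
  have hMz (y : M.Realization) : ∃ v ∈ σ, y.1 v = 0 := by
    obtain ⟨v, hv, hvy⟩ := Finset.not_subset.1 (hMσ _ y.carrier_mem)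
    exact ⟨v, hv, eq_zero_of_notMem_carrier hvy⟩
  -- For `τ = 0` this keeps all coordinates. For `τ > 0` it moves `y` part of the way to the
  -- barycenter, which makes the coordinates on `σ` positive and so lands in the open star.
  let j₀ : M.Realization → K.Realization := fun y =>
    ⟨fun v => (1 - τ) * y.1 v + τ * barycenter σ v, by
      obtain ⟨s, hs, hys, hs'⟩ := hMK _ y.carrier_mem
      exact exists_cone_point hσ y hs hys hτ0 hτ1.le hs'⟩
  have hj₀ : Continuous j₀ := by
    refine continuous_of_coord (fun s _ => ⟨s ∪ σ, fun x hx v hv => ?_⟩) fun v => ?_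
    · rw [Finset.mem_union, not_or] at hv
      simp [j₀, hx v hv.1, barycenter_of_notMem hv.2]
    · simp only [j₀]; fun_prop
  let j : C(M.Realization, P) := ⟨fun y => ⟨j₀ y, (hP _).2 ⟨hne hτ1 (hMz y), by
    rcases hτ0.eq_or_lt with h | h
    · exact Or.inl h.symm
    · refine Or.inr fun v hv => ?_
      have h1 := y.nonneg v
      have h2 := barycenter_pos hv
      have h3 := sub_pos.2 hτ1
      simp only [j₀]
      positivity⟩⟩, hj₀.subtype_mk _⟩
  let ρ : P → M.Realization := fun x => ⟨radialProjection σ hσ x.1.1, by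
    obtain ⟨s, hs, h1, h2, h3⟩ := exists_face_radialProjection hσ ((hP x.1).1 x.2).1
    exact ⟨s, hPM x.1 x.2 s hs h1 h2, h3⟩⟩
  refine isNConnected_of_straightLine hM j ρ (fun v => ?_)
    (fun x v hv => radialProjection_eq_zero hσ hv) (fun x => ?_) fun x t y hy => ?_
  · exact (continuousOn_radialProjection hσ v).comp_continuous continuous_subtype_val
      fun x => ((hP x.1).1 x.2).1
  · refine ⟨x.1.carrier, x.1.carrier_mem, fun v hv => eq_zero_of_notMem_carrier hv,
      fun v hv => ?_⟩
    have hv0 : x.1.1 v = 0 := eq_zero_of_notMem_carrier hv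
    have h1 : radialProjection σ hσ x.1.1 v = 0 := radialProjection_eq_zero hσ hv0
    change (1 - τ) * radialProjection σ hσ x.1.1 v + τ * barycenter σ v = 0
    rw [h1]
    rcases ((hP x.1).1 x.2).2 with h | h
    · simp [h]
    · have : v ∉ σ := fun h' => (h v h').ne' hv0
      simp [barycenter_of_notMem this]
  · have hx := (hP x.1).1 x.2
    have hw0 := barycenterWeight_nonneg hσ x.1
    have hw1 := barycenterWeight_lt_one hσ hx.1
    set w := barycenterWeight σ hσ x.1.1 with hw
    have ht0 := t.2.1
    have ht1 := t.2.2
    -- Each point of the segment lies on the ray from the barycenter through the projection, with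
    -- weight strictly below `1` at the barycenter. As the projection has a zero coordinate on `σ`,
    -- the segment avoids the barycenter.
    have hy' (v) : y.1 v = (1 - ((1 - (t : ℝ)) * w + t * τ)) * radialProjection σ hσ x.1.1 v +
        ((1 - (t : ℝ)) * w + t * τ) * barycenter σ v := by
      rw [hy v, eq_radialProjection hσ hx.1 v]
      change _ + (t : ℝ) * ((1 - τ) * radialProjection σ hσ x.1.1 v + τ * barycenter σ v) = _
      rw [← hw]
      ring
    have hlt : (1 - (t : ℝ)) * w + t * τ < 1 := by
      rcases ht1.eq_or_lt with h | h
      · rw [h]; linarith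
      · nlinarith
    refine (hP y).2 ⟨?_, ?_⟩
    · rw [funext hy']
      exact hne hlt (exists_radialProjection_eq_zero hσ x.1.1)
    · rcases hτ0.eq_or_lt with h | h
      · exact Or.inl h.symm
      refine Or.inr fun v hv => ?_
      have h1 := (hx.2.resolve_left h.ne') v hv
      have h2 : 0 < (j (ρ x)).1.1 v := by
        have h3 := (ρ x).nonneg v
        have h4 := barycenter_pos hv
        have h5 := sub_pos.2 hτ1
        change 0 < (1 - τ) * (ρ x).1 v + τ * barycenter σ v
        positivity
      rw [hy v]
      rcases ht1.eq_or_lt with h' | h'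
      · simpa [h'] using h2
      · have := sub_pos.2 h'
        positivity

/-- Attaching the open star of a simplex `σ` along the boundary of its star. -/
theorem isNConnected_of_deletion {m : ℤ} (hσ : σ ∈ K.faces)
    (hA : IsNConnected m (K.deletion σ).Realization)
    (hL : IsNConnected (m - 1) (K.starBoundary σ).Realization) : IsNConnected m K.Realization := by
  have hne := face_nonempty hσ
  let U : Set K.Realization := {x | x.1 ≠ barycenter σ}
  let O : Set K.Realization := {x | ∀ v ∈ σ, 0 < x.1 v}
  let b : K.Realization := ⟨barycenter σ, σ, hσ, barycenter_nonneg σ,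
    fun v hv => barycenter_of_notMem hv, sum_barycenter hne subset_rfl⟩
  have hb : b ∈ O := fun v hv => barycenter_pos hv
  have hsub {x : K.Realization} (hx : x ∈ O) : σ ⊆ x.carrier := fun v hv =>
    mem_carrier.2 (hx v hv).ne'
  have hUo : IsOpen U := by
    have : U = {x | x.1 = barycenter σ}ᶜ := rfl
    rw [this, isOpen_compl_iff]
    simp only [funext_iff, Set.ofPred_forall]
    exact isClosed_iInter fun v => isClosed_eq (continuous_coord v) continuous_const
  have hOo : IsOpen O := by
    have : O = ⋂ v ∈ σ, {x | 0 < x.1 v} := by ext; simp [O]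
    rw [this]
    exact isOpen_biInter_finset fun v _ => isOpen_lt continuous_const (continuous_coord v)
  have hcover : U ∪ O = Set.univ := by
    refine Set.eq_univ_of_forall fun x => ?_
    by_cases hx : x.1 = barycenter σ
    · right
      have : x = b := Subtype.ext hx
      rw [this]
      exact hb
    · exact Or.inl hx
  -- The complement `U` of the barycenter projects to the deletion, the open star `O` is star-shaped
  -- about the barycenter, and `U ∩ O` projects to the boundary of the star.
  refine IsNConnected.of_open_cover hUo hOo hcover ?_ ?_ ?_
  · refine isNConnected_of_radialProjection hne hA le_rfl zero_lt_one
      (fun t ht => ⟨t, ht.1, subset_rfl, Or.inl rfl⟩) (fun t ht => ht.2) (fun x => ?_)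
      fun x _ s hs hs0 hσs => ⟨face_mono x.carrier_mem hs hs0, hσs⟩
    simp [U]
  · refine ⟨fun _ => ⟨⟨b, hb⟩⟩, fun k _ f => ⟨⟨b, hb⟩, ?_⟩⟩
    let val : C(O, K.Realization) := ⟨Subtype.val, continuous_subtype_val⟩
    obtain ⟨H, hH⟩ := exists_straightLine_homotopy (val.comp f)
      (val.comp (ContinuousMap.const _ ⟨b, hb⟩)) fun z =>
        ⟨(f z).1.carrier, (f z).1.carrier_mem, fun v hv => eq_zero_of_notMem_carrier hv,
          fun v hv => barycenter_of_notMem fun h => hv (hsub (f z).2 h)⟩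
    refine ⟨⟨⟨fun p => ⟨H p, fun v hv => ?_⟩, H.continuous.subtype_mk _⟩,
      fun z => Subtype.ext (H.apply_zero z), fun z => Subtype.ext (H.apply_one z)⟩⟩
    rw [hH p.1 p.2 v]
    change 0 < (1 - (p.1 : ℝ)) * (f p.2).1.1 v + p.1 * barycenter σ v
    have h1 := (f p.2).2 v hv
    have h2 := barycenter_pos hv
    have ht0 := p.1.2.1
    rcases p.1.2.2.eq_or_lt with h | h
    · simpa [h] using h2
    · have := sub_pos.2 h
      positivity
  -- Any `τ` strictly between `0` and `1` would serve.
  · refine isNConnected_of_radialProjection hne hL (τ := 1 / 2) (by norm_num) (by norm_num)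
      (fun t ht => ⟨t ∪ σ, ht.2.2, Finset.subset_union_left, Or.inr Finset.subset_union_right⟩)
      (fun t ht => ht.2.1) (fun x => ?_) fun x hx s hs hs0 hσs =>
        ⟨face_mono x.carrier_mem hs hs0, hσs, ?_⟩
    · simp [U, O]
    · exact face_mono x.carrier_mem (Finset.union_subset hs (hsub hx.2))
        (hs0.mono Finset.subset_union_left)

end Realization
end PreAbstractSimplicialComplex

theorem IsNConnected.mono {T : Type*} [TopologicalSpace T] {m m' : ℤ} (h : IsNConnected m T)
    (hm : m' ≤ m) : IsNConnected m' T :=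
  ⟨fun h' => h.1 (h'.trans hm), fun k hk => h.2 k (hk.trans hm)⟩

/-! ### Joins with the boundary of a simplex -/

namespace PreAbstractSimplicialComplex

/-- The join of the boundary of the simplex `σ` with `M`, when the faces of `M` are disjoint
from `σ`. -/
def boundaryJoin {V : Type*} [DecidableEq V] (σ : Finset V) (M : PreAbstractSimplicialComplex V) :
    PreAbstractSimplicialComplex V where
  faces := {t | t.Nonempty ∧ ¬σ ⊆ t ∧ ((t \ σ).Nonempty → t \ σ ∈ M.faces)}
  isRelLowerSet_faces := fun _ ht => ⟨ht.1, fun _ hr hne => ⟨hne, fun h => ht.2.1 (h.trans hr),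
    fun h => face_mono (ht.2.2 (h.mono (Finset.sdiff_subset_sdiff hr subset_rfl)))
      (Finset.sdiff_subset_sdiff hr subset_rfl) h⟩⟩

/-- The join `∂σ * M` is a `p`-fold suspension of `M`. In the inductive step for `insert v σ`,
deleting the face `σ` leaves a cone with apex `v`, and the boundary of the star of `σ` is `∂σ * M`.
-/
theorem isNConnected_boundaryJoin {V : Type*} [DecidableEq V] {M : PreAbstractSimplicialComplex V}
    {m : ℤ} (hM : IsNConnected m M.Realization) (p : ℕ) :
    ∀ σ : Finset V, σ.card = p + 1 → (∀ t ∈ M.faces, Disjoint t σ) →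
      IsNConnected (m + p) (boundaryJoin σ M).Realization := by
  induction p with
  | zero =>
    intro σ hσ hd
    obtain ⟨v, rfl⟩ := Finset.card_eq_one.1 hσ
    have : boundaryJoin {v} M = M := by
      ext t
      constructor
      · rintro ⟨h1, h2, h3⟩
        rw [Finset.singleton_subset_iff] at h2
        rw [Finset.sdiff_eq_self_of_disjoint (Finset.disjoint_singleton_right.2 h2)] at h3
        exact h3 h1
      · intro ht
        have hv : v ∉ t := Finset.disjoint_singleton_right.1 (hd t ht)
        refine ⟨face_nonempty ht, by simpa using hv, ?_⟩
        rw [Finset.sdiff_eq_self_of_disjoint (Finset.disjoint_singleton_right.2 hv)]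
        exact fun _ => ht
    rw [this]
    simpa using hM
  | succ p ih =>
    intro σ' hσ' hd
    obtain ⟨v, σ, hv, rfl, hσ⟩ := Finset.card_eq_succ.1 hσ'
    have hne : σ.Nonempty := Finset.card_pos.1 (by omega)
    have hd' : ∀ t ∈ M.faces, v ∉ t ∧ Disjoint t σ := fun t ht =>
      Finset.disjoint_insert_right.1 (hd t ht)
    refine Realization.isNConnected_of_deletion (σ := σ) ⟨hne, ?_, ?_⟩ ?_ ?_
    · exact fun h => hv (h (Finset.mem_insert_self _ _))
    · simp
    · have hσv : ¬σ ⊆ {v} := by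
        obtain ⟨u, hu⟩ := hne
        exact fun h => hv (Finset.mem_singleton.1 (h hu) ▸ hu)
      refine Realization.isNConnected_of_cone v ?_ ?_ _
      · exact ⟨⟨by simp, fun h => hσv ((Finset.subset_insert _ _).trans h), by simp⟩, hσv⟩
      · rintro s ⟨⟨h1, h2, h3⟩, h4⟩
        have h5 : ¬σ ⊆ insert v s := fun h => h4 ((Finset.subset_insert_iff_of_notMem hv).1 h)
        refine ⟨⟨by simp, fun h => h5 ((Finset.subset_insert _ _).trans h), ?_⟩, h5⟩
        rwa [Finset.insert_sdiff_of_mem _ (Finset.mem_insert_self _ _)]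
    · have : (boundaryJoin (insert v σ) M).starBoundary σ = boundaryJoin σ M := by
        ext t
        constructor
        · rintro ⟨⟨h1, -, h3⟩, h4, -, h6, -⟩
          have hvt : v ∉ t := fun h => h6 (Finset.insert_subset (Finset.mem_union_left _ h)
            Finset.subset_union_right)
          rw [Finset.sdiff_insert_of_notMem hvt] at h3
          exact ⟨h1, h4, h3⟩
        · rintro ⟨h1, h2, h3⟩
          have hvt : v ∉ t := fun h => by
            have h' : v ∈ t \ σ := Finset.mem_sdiff.2 ⟨h, hv⟩
            exact (hd' _ (h3 ⟨v, h'⟩)).1 h'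
          refine ⟨⟨h1, fun h => hvt (h (Finset.mem_insert_self _ _)), ?_⟩, h2,
            h1.mono Finset.subset_union_left, fun h => ?_, ?_⟩
          · rwa [Finset.sdiff_insert_of_notMem hvt]
          · rcases Finset.mem_union.1 (h (Finset.mem_insert_self _ _)) with h | h
            exacts [hvt h, hv h]
          · have : (t ∪ σ) \ insert v σ = t \ σ := by grind
            rwa [this]
      rw [this]
      convert ih σ hσ fun t ht => (hd' t ht).2 using 1
      push_cast
      ring

/-! ### The complex interpolating between `X` and `Y` -/

section LinkJoin

variable {V W : Type*} [DecidableEq V] [DecidableEq W]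

/-- The complex of the simplices `a ⊔ b` with `a` in `G`, `b` a face of `X`, and `b` in the link of
`π a`, where `a` or `b` may be empty. -/
def linkJoin (X : PreAbstractSimplicialComplex W) (π : V → W) (G : Finset (Finset V))
    (hG : ∀ s ∈ G, ∀ r ⊆ s, r.Nonempty → r ∈ G) : PreAbstractSimplicialComplex (V ⊕ W) where
  faces := {t | t.Nonempty ∧ (t.toLeft.Nonempty → t.toLeft ∈ G) ∧
    (t.toRight.Nonempty → t.toRight ∈ X.faces) ∧ (t.toLeft.Nonempty → t.toRight.Nonempty →
      t.toRight ∈ (X.link (t.toLeft.image π)).faces)}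
  isRelLowerSet_faces := by
    rintro t ⟨h1, h2, h3, h4⟩
    refine ⟨h1, fun r hr hne => ?_⟩
    have hl : r.toLeft ⊆ t.toLeft := Finset.toLeft_subset_toLeft hr
    have hr : r.toRight ⊆ t.toRight := Finset.toRight_subset_toRight hr
    refine ⟨hne, fun h => hG _ (h2 (h.mono hl)) _ hl h,
      fun h => face_mono (h3 (h.mono hr)) hr h, fun h h' => ?_⟩
    obtain ⟨h5, h6, h7⟩ := h4 (h.mono hl) (h'.mono hr)
    have hi : r.toLeft.image π ⊆ t.toLeft.image π := Finset.image_subset_image hl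
    exact ⟨face_mono h5 hr h', Finset.disjoint_of_subset_left hr
      (Finset.disjoint_of_subset_right hi h6), face_mono h7 (Finset.union_subset_union hr hi)
      (h'.mono Finset.subset_union_left)⟩

theorem isNConnected_linkJoin_empty {X : PreAbstractSimplicialComplex W} (π : V → W) {m : ℤ}
    (hX : IsNConnected m X.Realization) :
    IsNConnected m (linkJoin X π ∅ (by simp)).Realization := by
  -- For `m < -1` nothing is claimed. Otherwise `X` has a vertex `w₀`, needed as a default value on
  -- the left summand when mapping back to `X`.
  by_cases hm : m < -1
  · exact ⟨fun h => by omega, fun k hk => by omega⟩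
  obtain ⟨x⟩ := hX.1 (by omega)
  obtain ⟨w₀, -⟩ := face_nonempty x.carrier_mem
  have hmem {t : Finset (V ⊕ W)} (ht : t ∈ (linkJoin X π ∅ (by simp)).faces) :
      t.toLeft = ∅ ∧ t.toRight ∈ X.faces := by
    obtain ⟨h1, h2, h3, -⟩ := ht
    have hl : t.toLeft = ∅ := by
      by_contra h
      simpa using h2 (Finset.nonempty_iff_ne_empty.2 h)
    refine ⟨hl, h3 ?_⟩
    obtain ⟨u | u, hu⟩ := h1
    · rw [← Finset.mem_toLeft, hl] at hu
      simp at hu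
    · exact ⟨u, Finset.mem_toRight.2 hu⟩
  refine Realization.isNConnected_of_retract hX Sum.inr (fun s hs => ?_)
    (Sum.elim (fun _ => w₀) id) (fun t ht => ?_) fun t ht u hu => ?_
  · have hl : (s.image (Sum.inr : W → V ⊕ W)).toLeft = ∅ := by ext; simp
    have hr : (s.image (Sum.inr : W → V ⊕ W)).toRight = s := by ext; simp
    refine ⟨(face_nonempty hs).image _, ?_, ?_, ?_⟩
    · rw [hl]; simp
    · rw [hr]; exact fun _ => hs
    · rw [hl]; simp
  · obtain ⟨hl, hr⟩ := hmem ht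
    convert hr
    ext w
    simp only [Finset.mem_image, Finset.mem_toRight]
    constructor
    · rintro ⟨u | u, hu, rfl⟩
      · rw [← Finset.mem_toLeft, hl] at hu
        simp at hu
      · exact hu
    · exact fun h => ⟨_, h, rfl⟩
  · rcases u with u | u
    · rw [← Finset.mem_toLeft, (hmem ht).1] at hu
      simp at hu
    · rfl

/-- Simplices of `G` are removed one at a time, largest first, down to the copy of `X` at `G = ∅`.
Each removal is a deletion whose star boundary is `∂σ * Lk_X (π σ)`, of connectivity `(n - p - 2) +
p = (n - 1) - 1`. -/
theorem isNConnected_linkJoin {X : PreAbstractSimplicialComplex W} {π : V → W} {n : ℤ}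
    (hX : X.IsWeaklyCohenMacaulay n) (G : Finset (Finset V)) :
    ∀ hG : ∀ s ∈ G, ∀ r ⊆ s, r.Nonempty → r ∈ G, (∀ s ∈ G, s.image π ∈ X.faces) →
      IsNConnected (n - 1) (linkJoin X π G hG).Realization := by
  induction G using Finset.strongInduction with
  | H G ih =>
  intro hG hGX
  rcases G.eq_empty_or_nonempty with rfl | hne
  · exact isNConnected_linkJoin_empty π hX.1
  obtain ⟨σ, hσG, hmax⟩ := G.exists_max_image Finset.card hne
  -- Maximality keeps `G.erase σ` closed under faces and forces every simplex of the complex that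
  -- contains `σ` to have left part exactly `σ`.
  have hmax' {s} (hs : s ∈ G) (h : σ ⊆ s) : s = σ :=
    (Finset.eq_of_subset_of_card_le h (hmax s hs)).symm
  have hσ : σ.Nonempty := Finset.image_nonempty.1 (face_nonempty (hGX σ hσG))
  let σ' : Finset (V ⊕ W) := σ.image Sum.inl
  have hσl : σ'.toLeft = σ := by ext; simp [σ']
  have hσr : σ'.toRight = ∅ := by ext; simp [σ']
  have hsub (t : Finset (V ⊕ W)) : σ' ⊆ t ↔ σ ⊆ t.toLeft := by
    simp [σ', Finset.subset_iff]
  have hul (t : Finset (V ⊕ W)) : (t ∪ σ').toLeft = t.toLeft ∪ σ := by ext; simp [σ']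
  have hur (t : Finset (V ⊕ W)) : (t ∪ σ').toRight = t.toRight := by ext; simp [σ']
  have hdl (t : Finset (V ⊕ W)) : (t \ σ').toLeft = t.toLeft \ σ := by ext; simp [σ']
  have hdr (t : Finset (V ⊕ W)) : (t \ σ').toRight = t.toRight := by ext; simp [σ']
  have hLR {t : Finset (V ⊕ W)} (hl : t.toLeft = ∅) (hr : t.toRight = ∅) : t = ∅ := by
    rw [← Finset.toLeft_disjSum_toRight (u := t), hl, hr]
    simp
  have hE : ∀ s ∈ G.erase σ, ∀ r ⊆ s, r.Nonempty → r ∈ G.erase σ := by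
    intro s hs r hr hr0
    obtain ⟨h1, h2⟩ := Finset.mem_erase.1 hs
    refine Finset.mem_erase.2 ⟨fun h => h1 (hmax' h2 (h ▸ hr)), hG s h2 r hr hr0⟩
  have hdel : (linkJoin X π G hG).deletion σ' = linkJoin X π (G.erase σ) hE := by
    ext t
    constructor
    · rintro ⟨⟨h1, h2, h3, h4⟩, h5⟩
      rw [hsub] at h5
      exact ⟨h1, fun h => Finset.mem_erase.2 ⟨fun h' => h5 h'.ge, h2 h⟩, h3, h4⟩
    · rintro ⟨h1, h2, h3, h4⟩
      refine ⟨⟨h1, fun h => Finset.mem_of_mem_erase (h2 h), h3, h4⟩, ?_⟩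
      rw [hsub]
      intro h
      obtain ⟨h5, h6⟩ := Finset.mem_erase.1 (h2 (hσ.mono h))
      exact h5 (hmax' h6 h)
  -- This is the link of `π σ`, copied into the right summand.
  let M : PreAbstractSimplicialComplex (V ⊕ W) :=
    linkJoin (X.link (σ.image π)) π (∅ : Finset (Finset V)) (by simp)
  have hM {t : Finset (V ⊕ W)} : t ∈ M.faces ↔
      t.toLeft = ∅ ∧ t.toRight ∈ (X.link (σ.image π)).faces := by
    constructor
    · rintro ⟨h1, h2, h3, -⟩
      have hl : t.toLeft = ∅ := by
        by_contra h
        simpa using h2 (Finset.nonempty_iff_ne_empty.2 h)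
      refine ⟨hl, h3 (Finset.nonempty_iff_ne_empty.2 fun hr => ?_)⟩
      exact h1.ne_empty (hLR hl hr)
    · rintro ⟨hl, hr⟩
      obtain ⟨w, hw⟩ := face_nonempty hr
      exact ⟨⟨_, Finset.mem_toRight.1 hw⟩, by simp [hl], fun _ => hr, by simp [hl]⟩
  have hstar : (linkJoin X π G hG).starBoundary σ' = boundaryJoin σ' M := by
    ext t
    constructor
    · rintro ⟨⟨h1, -, -, -⟩, h5, ⟨-, h6, -, h8⟩⟩
      rw [hul] at h6
      rw [hul, hur] at h8
      have hnel : (t.toLeft ∪ σ).Nonempty := hσ.mono Finset.subset_union_right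
      have hu : t.toLeft ∪ σ = σ := hmax' (h6 hnel) Finset.subset_union_right
      have hdl0 : (t \ σ').toLeft = ∅ := by
        rw [hdl, Finset.sdiff_eq_empty_iff_subset]
        exact Finset.union_eq_right.1 hu
      refine ⟨h1, h5, fun h => hM.2 ⟨hdl0, ?_⟩⟩
      rw [hdr]
      have hr0 : t.toRight.Nonempty := by
        rw [Finset.nonempty_iff_ne_empty]
        intro h'
        exact h.ne_empty (hLR hdl0 (by rw [hdr, h']))
      rw [hu] at h8
      exact h8 hσ hr0
    · rintro ⟨h1, h2, h3⟩
      have hls : t.toLeft ⊆ σ := by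
        rw [← Finset.sdiff_eq_empty_iff_subset, ← hdl]
        rcases (t \ σ').eq_empty_or_nonempty with h | h
        · rw [h]; rfl
        · exact (hM.1 (h3 h)).1
      have hrs : t.toRight.Nonempty → t.toRight ∈ (X.link (σ.image π)).faces := by
        rintro ⟨w, hw⟩
        rw [← hdr]
        refine (hM.1 (h3 ⟨Sum.inr w, ?_⟩)).2
        rw [← Finset.mem_toRight, hdr]
        exact hw
      have hmem : t ∪ σ' ∈ (linkJoin X π G hG).faces := by
        refine ⟨h1.mono Finset.subset_union_left, ?_, ?_, ?_⟩
        · rw [hul, Finset.union_eq_right.2 hls]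
          exact fun _ => hσG
        · rw [hur]
          exact fun h => (hrs h).1
        · rw [hul, hur, Finset.union_eq_right.2 hls]
          exact fun _ => hrs
      exact ⟨face_mono hmem Finset.subset_union_left h1, h2, hmem⟩
  obtain ⟨p, hp⟩ : ∃ p, σ.card = p + 1 := ⟨σ.card - 1, by have := hσ.card_pos; omega⟩
  obtain ⟨q, hq⟩ : ∃ q, (σ.image π).card = q + 1 :=
    ⟨(σ.image π).card - 1, by have := (hσ.image π).card_pos; omega⟩
  -- Since `π` may identify vertices of `σ`, its image is a `q`-simplex with `q ≤ p`, whose link is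
  -- at least as connected as needed.
  have hqp : q ≤ p := by
    have := Finset.card_image_le (s := σ) (f := π)
    omega
  refine Realization.isNConnected_of_deletion (σ := σ') ?_ ?_ ?_
  · refine ⟨hσ.image _, fun _ => hσl ▸ hσG, ?_, ?_⟩ <;> simp [hσr]
  · rw [hdel]
    exact ih _ (Finset.erase_ssubset hσG) hE fun s hs => hGX s (Finset.mem_of_mem_erase hs)
  · rw [hstar]
    have hlink : IsNConnected (n - p - 2) (X.link (σ.image π)).Realization :=
      (hX.2 _ (hGX σ hσG) q hq).mono (by omega)
    convert isNConnected_boundaryJoin (isNConnected_linkJoin_empty π hlink) p σ' ?_ ?_ using 1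
    · ring
    · rw [← hp]
      exact Finset.card_image_of_injective _ Sum.inl_injective
    · intro t ht
      rw [Finset.disjoint_right]
      intro u hu hut
      obtain ⟨v, -, rfl⟩ := Finset.mem_image.1 hu
      rw [← Finset.mem_toLeft, (hM.1 ht).1] at hut
      simp at hut

/-! ### From sections to connectivity, and links of links -/

/-- A simplicial map onto a weakly Cohen–Macaulay complex with sections compatible with the links
of any finite set of simplices has a highly connected source. -/
theorem isNConnected_of_sections {Y : PreAbstractSimplicialComplex V}
    {X : PreAbstractSimplicialComplex W} {π : V → W} {n : ℤ}
    (hX : X.IsWeaklyCohenMacaulay n) (hπ : ∀ s ∈ Y.faces, s.image π ∈ X.faces)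
    (hsec : ∀ S : Finset V, ∃ ρ : W → V, (∀ t ∈ X.faces, t.image ρ ∈ Y.faces) ∧
      ∀ s ∈ Y.faces, s ⊆ S → ∀ t ∈ (X.link (s.image π)).faces, t.image ρ ∪ s ∈ Y.faces) :
    IsNConnected (n - 1) Y.Realization := by
  classical
  refine ⟨fun hn => ?_, fun k hk f => ?_⟩
  · obtain ⟨ρ, hρ, -⟩ := hsec ∅
    exact (hX.1.1 hn).map (Realization.map ρ hρ)
  obtain ⟨S, hS⟩ := Realization.exists_finite_support f
  obtain ⟨ρ, hρ, hρS⟩ := hsec S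
  let G : Finset (Finset V) := S.powerset.filter fun s => s ∈ Y.faces
  have hmemG {s} : s ∈ G ↔ s ⊆ S ∧ s ∈ Y.faces := by simp [G]
  have hG : ∀ s ∈ G, ∀ r ⊆ s, r.Nonempty → r ∈ G := fun s hs r hr hr0 =>
    hmemG.2 ⟨hr.trans (hmemG.1 hs).1, face_mono (hmemG.1 hs).2 hr hr0⟩
  have hJ := isNConnected_linkJoin hX G hG fun s hs => hπ s (hmemG.1 hs).2
  -- The full subcomplex of `Y` on `S`, through which `f` factors as `g`.
  let YS : PreAbstractSimplicialComplex V :=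
    ⟨{s | s ∈ G}, fun s hs => ⟨face_nonempty (hmemG.1 hs).2, fun r hr hr0 => hG s hs r hr hr0⟩⟩
  let g : C(Metric.sphere (0 : EuclideanSpace ℝ (Fin (k + 1))) 1, YS.Realization) :=
    ⟨fun z => ⟨(f z).1, (f z).carrier,
        hmemG.2 ⟨Realization.carrier_subset (hS z), (f z).carrier_mem⟩,
        (f z).mem_geometricSimplex fun v hv => Realization.eq_zero_of_notMem_carrier hv⟩,
      Realization.continuous_of_finite_support S hS
        fun v => ((Realization.continuous_coord v).comp f.continuous :
          Continuous fun z => (f z).1 v)⟩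
  have hφ : ∀ s ∈ YS.faces, s.image Sum.inl ∈ (linkJoin X π G hG).faces := by
    intro s hs
    have hl : (s.image (Sum.inl : V → V ⊕ W)).toLeft = s := by ext; simp
    have hr : (s.image (Sum.inl : V → V ⊕ W)).toRight = ∅ := by ext; simp
    refine ⟨(face_nonempty hs).image _, fun _ => hl.symm ▸ hs, ?_, ?_⟩ <;> simp [hr]
  -- The section property enters here: a mixed simplex `a ⊔ b` goes to `a ∪ ρ b`, a simplex of `Y`
  -- because `b` lies in the link of `π a` and `a ⊆ S`.
  have hψ : ∀ t ∈ (linkJoin X π G hG).faces, t.image (Sum.elim id ρ) ∈ Y.faces := by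
    rintro t ⟨h1, h2, h3, h4⟩
    have ht : t.image (Sum.elim id ρ) = t.toRight.image ρ ∪ t.toLeft := by
      ext v
      simp only [Finset.mem_image, Finset.mem_union, Finset.mem_toLeft, Finset.mem_toRight,
        Sum.exists, Sum.elim_inl, Sum.elim_inr, id_eq, exists_eq_right]
      exact or_comm
    rw [ht]
    rcases t.toLeft.eq_empty_or_nonempty with hl | hl
    · have hr : t.toRight.Nonempty := by
        obtain ⟨u | u, hu⟩ := h1
        · rw [← Finset.mem_toLeft, hl] at hu
          simp at hu
        · exact ⟨u, Finset.mem_toRight.2 hu⟩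
      rw [hl, Finset.union_empty]
      exact hρ _ (h3 hr)
    · obtain ⟨h5, h6⟩ := hmemG.1 (h2 hl)
      rcases t.toRight.eq_empty_or_nonempty with hr | hr
      · rw [hr, Finset.image_empty, Finset.empty_union]
        exact h6
      · exact hρS _ h6 h5 _ (h4 hl hr)
  have hnull := (hJ.2 k hk ((⟨Realization.map _ hφ, Realization.continuous_map _ hφ⟩ :
    C(_, _)).comp g)).comp_right ⟨Realization.map _ hψ, Realization.continuous_map _ hψ⟩
  convert hnull using 1
  ext z : 1
  exact Subtype.ext (Realization.map_map_eq _ hφ _ hψ (g z) fun _ _ => rfl).symm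

/-- The link of `t` in the link of `s` is the link of `t ∪ s`, a simplex of dimension `q + p + 1`,
and `n - (q + p + 1) - 2 = (n - p - 1) - q - 2`. -/
theorem IsWeaklyCohenMacaulay.link {X : PreAbstractSimplicialComplex W} {n : ℤ}
    (hX : X.IsWeaklyCohenMacaulay n) {s : Finset W} (hs : s ∈ X.faces) {p : ℕ}
    (hp : s.card = p + 1) : (X.link s).IsWeaklyCohenMacaulay (n - p - 1) := by
  refine ⟨(hX.2 s hs p hp).mono (by omega), fun t ht q hq => ?_⟩
  obtain ⟨h1, h2, h3⟩ := ht
  have : (X.link s).link t = X.link (t ∪ s) := by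
    ext r
    constructor
    · rintro ⟨⟨h4, h5, -⟩, h7, ⟨-, -, h10⟩⟩
      refine ⟨h4, Finset.disjoint_union_right.2 ⟨h7, h5⟩, ?_⟩
      rwa [← Finset.union_assoc]
    · rintro ⟨h4, h5, h6⟩
      obtain ⟨h7, h8⟩ := Finset.disjoint_union_right.1 h5
      have hr := face_nonempty h4
      refine ⟨⟨h4, h8, face_mono h6 (by grind) (hr.mono Finset.subset_union_left)⟩, h7,
        face_mono h6 (by grind) (hr.mono Finset.subset_union_left),
        Finset.disjoint_union_left.2 ⟨h8, h2⟩, ?_⟩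
      rwa [Finset.union_assoc]
  rw [this]
  refine (hX.2 (t ∪ s) h3 (q + p + 1) ?_).mono (by push_cast; omega)
  rw [Finset.card_union_of_disjoint h2]
  omega

end LinkJoin

end PreAbstractSimplicialComplex

/-! ### The proposition -/

open PreAbstractSimplicialComplex in
theorem mainTheorem3 {V W : Type*} [DecidableEq V] [DecidableEq W]
    (Y : AbstractSimplicialComplex V) (X : AbstractSimplicialComplex W) (π : V → W) (n : ℤ)
    (hπ : AbstractSimplicialComplex.IsFinRetraction Y X π)
    (hX : X.toPreAbstractSimplicialComplex.IsWeaklyCohenMacaulay n) :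
    IsNConnected (n - 1) Y.toPreAbstractSimplicialComplex.Realization ∧
      (AbstractSimplicialComplex.IsSimplexwiseInjective Y π →
        Y.toPreAbstractSimplicialComplex.IsWeaklyCohenMacaulay n) := by
  obtain ⟨hsimp, -, hsec⟩ := hπ
  have hY : IsNConnected (n - 1) Y.toPreAbstractSimplicialComplex.Realization := by
    refine isNConnected_of_sections hX hsimp fun S => ?_
    obtain ⟨ρ, h1, -, h3⟩ := hsec S S.finite_toSet
    exact ⟨ρ, h1, fun s hs hsS t ht => ((h3 s hs (Finset.coe_subset.2 hsS) t ht.1).1 ht).2.2⟩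
  refine ⟨hY, fun hinj => ⟨hY, fun s hs p hp => ?_⟩⟩
  have hcard : (s.image π).card = p + 1 := by
    rw [Finset.card_image_of_injOn (hinj s hs), hp]
  have key : IsNConnected (n - p - 1 - 1) (Y.toPreAbstractSimplicialComplex.link s).Realization := by
    refine isNConnected_of_sections (hX.link (hsimp s hs) hcard) (π := π) (fun t ht => ?_)
      fun S => ?_
    · obtain ⟨h1, h2, h3⟩ := ht
      refine ⟨hsimp t h1, ?_, ?_⟩
      -- A vertex of `t` and one of `s` lie in the common simplex `t ∪ s`, so injectivity keeps
      -- their images apart.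
      · rw [Finset.disjoint_left]
        intro w hw hw'
        obtain ⟨u, hu, rfl⟩ := Finset.mem_image.1 hw
        obtain ⟨v, hv, huv⟩ := Finset.mem_image.1 hw'
        have := hinj _ h3 (Finset.mem_coe.2 (Finset.mem_union_right _ hv))
          (Finset.mem_coe.2 (Finset.mem_union_left _ hu)) huv
        exact Finset.disjoint_left.1 h2 hu (this ▸ hv)
      · rw [← Finset.image_union]
        exact hsimp _ h3
    -- Enlarging `S` by `s` lets the section property apply to `s` itself, so that `ρ` maps link to
    -- link, and to `r ∪ s` for each `r ⊆ S` in the link of `s`.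
    · obtain ⟨ρ, -, -, h3⟩ := hsec (S ∪ s : Finset V) (Finset.finite_toSet _)
      refine ⟨ρ, fun t ht => (h3 s hs (by simp) t ht.1).1 ht, fun r hr hrS t ht => ?_⟩
      obtain ⟨hr1, hr2, hr3⟩ := hr
      obtain ⟨⟨ht1, ht2, ht3⟩, ht4, -, -, ht5⟩ := ht
      have hlink : t ∈ (X.toPreAbstractSimplicialComplex.link ((r ∪ s).image π)).faces := by
        rw [Finset.image_union]
        exact ⟨ht1, Finset.disjoint_union_right.2 ⟨ht4, ht2⟩, by
          rwa [← Finset.union_assoc]⟩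
      obtain ⟨h4, h5, h6⟩ := (h3 (r ∪ s) hr3 (Finset.coe_subset.2
        (Finset.union_subset_union_left hrS)) t ht1).1 hlink
      rw [← Finset.union_assoc] at h6
      exact ⟨face_mono h6 Finset.subset_union_left
          ((face_nonempty h4).mono Finset.subset_union_left),
        Finset.disjoint_union_left.2 ⟨(Finset.disjoint_union_right.1 h5).2, hr2⟩, h6⟩
  exact key.mono (by omega)
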